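/- For a $k$-uniform hypergraph $H$ and $1\le d\le k-1$, let $\delta_d(H)$ be the minimum, over all sets $D$ of $d$ vertices of $H$, of the number of edges of $H$ that contain $D$; for $U\subseteq V(H)$ let $H[U]$ be the subhypergraph with vertex set $U$ whose edges are the edges of $H$ contained in $U$. Let $k,d,t\in\mathbb N$ with $1\le d\le k-1$ and $t\ge 1$, and let $\alpha,\varepsilon\in(0,1]$. There is $C_0=C_0(k,d,t,\alpha,\varepsilon)$ such that for every integer $C\ge C_0$ there is $C'_0$ (depending on $k,d,t,\alpha,\varepsilon,C$) such that for every real $C'\ge C'_0$ there is $n_0$ (depending on $k,d,t,\alpha,\varepsilon,C,C'$) such that the following holds for every $n\ge n_0$ and every $\delta\in[0,1]$. If $H$ is a $k$-uniform hypergraph on $n$ vertices with $\delta_d(H)\ge(\delta+\alpha)\binom{n-d}{k-d}$, then there are an integer $m\ge 1$ and a random (indexed) partition $\mathcal U=\{U_1,\dots,U_m\}$ of $V(H)$ such that (1)--(3) hold for every outcome, and (4) holds: 1. $|U_i|=C$ for each $2\le i\le m$, and $|U_1|$ equals $(C-1)C$ plus the remainder when $n$ is divided by $(C-1)C$; 2.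 $\delta_d(H[U_i])\ge(\delta+\alpha/2)\binom{|U_i|}{k-d}$ for each $i\in[m]$; 3. for every $i\in[m]$ there exist $u_i\in U_i$, $T_i\subseteq U_i\setminus\{u_i\}$ of size $t$, and $N_i\subseteq\mathcal U\setminus\{U_i\}$ of size at least $(1-\varepsilon)m$ (chosen simultaneously for all $i$) such that for every $i\in[m]$ and every $U_j\in N_i$, $$\delta_d\big(H[(U_i\cup T_j)\setminus\{u_i\}]\big)\ge(\delta+\alpha/2)\binom{|U_i\cup T_j|}{k-d}\quad\text{and}\quad\delta_d\big(H[(U_j\cup T_i)\setminus\{u_j\}]\big)\ge(\delta+\alpha/2)\binom{|U_j\cup T_i|}{k-d};$$ 4. for every sequence of distinct vertices $y_1,\dots,y_s\in V(H)$ and every function $f\colon[s]\to[m]$, $$\mathbb P\big(y_i\in U_{f(i)}\text{ for each }i\in[s]\big)\le\left(\frac{C'}{n}\right)^s.$$ -/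

import Mathlib

namespace Hypergraph

/-- `H` is `k`-uniform: every edge consists of exactly `k` vertices. -/
def IsUniform {V : Type*} (H : Hypergraph V) (k : ℕ) : Prop :=
  ∀ e ∈ H.edgeSet, e.encard = k

/-- The induced subhypergraph `H[U]`: its vertices are the vertices of `H` in `U`, its edges are the
edges of `H` contained in `U`. -/
def induce {V : Type*} (H : Hypergraph V) (U : Set V) : Hypergraph V where
  vertexSet := H.vertexSet ∩ U
  edgeSet := {e | e ∈ H.edgeSet ∧ e ⊆ U}
  subset_vertexSet_of_mem_edgeSet' := fun _ he =>
    Set.subset_inter (H.subset_vertexSet_of_mem_edgeSet' he.1) he.2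

/-- The degree of a set `D` of vertices: the number of edges of `H` containing `D`. -/
noncomputable def degree {V : Type*} (H : Hypergraph V) (D : Set V) : ℕ :=
  {e | e ∈ H.edgeSet ∧ D ⊆ e}.ncard

/-- The minimum `d`-degree `δ_d(H)`: the minimum of the degrees of the sets of exactly `d` vertices
of `H` (and `0` if `H` has fewer than `d` vertices). -/
noncomputable def minDegree {V : Type*} (H : Hypergraph V) (d : ℕ) : ℕ :=
  sInf {x | ∃ D : Set V, D ⊆ H.vertexSet ∧ D.encard = d ∧ H.degree D = x}

end Hypergraph

/-- `U_1, …, U_m` (indexed by `Fin m`) is a partition of the set `S` into nonempty parts. -/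
def IsPartitionOf {V : Type*} {m : ℕ} (U : Fin m → Set V) (S : Set V) : Prop :=
  (∀ i, (U i).Nonempty) ∧ (∀ i j, i ≠ j → Disjoint (U i) (U j)) ∧ (⋃ i, U i) = S

namespace SpreadPartition

open Finset
open scoped Classical Nat ENNReal

/-! ### Counting bijections -/

/-! Put `c = C - 1`. Reserve an exceptional cluster of `b + 1 = c(c+1) + n % (c(c+1))` vertices and
cut the rest of a random ordering into `M = (c+1)q` blocks of size `c`. Discard `q` blocks; their
`cq` loose vertices are handed out one to each of the `N = cq` kept blocks, which become clusters of
size `C`, the added vertex being `u_i`. All degree conditions reduce to one notion, `Rich`: the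
`d`-subsets of `S ∪ T` have many completions inside `S` alone, measured against `#S + t + 1`, the
size of `U_i ∪ T_j`. The choice `T = {u_i}` gives the condition inside a cluster, `T = T_j` the
connecting one.

For a fixed `T`, a random `c`-tuple fails to be rich with probability at most `c^(-6)`
(`card_sparse_samples_le`, `card_not_rich_le`, `exists_card_not_rich_le`). This does not tend to `0`
with `n`, so some blocks may well fail. Disjoint blocks are almost independent, however, so about `M
/ c^4` failures for one `T` have probability exponentially small in `n`, which survives a union
bound over all `T`. For the single exceptional block, Markov's inequality over the sets `T_j`
suffices. Hence at least half of the orderings satisfy `GoodOrder`. Double counting then finds at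
most `q` blocks that behave badly towards many vertices or many `T_j`; these are among the discarded
ones (`exists_layout`). The graph of rich pairs between kept blocks and loose vertices has minimum
degree at least `3N/4`, and a perfect matching in it distributes the loose vertices.

For spreadness the matching is itself random: every vertex picks 20 random neighbours, with
probability at least `1/2` the picked graph satisfies Hall's condition, and a matching using only
picked edges inherits their spread (`exists_spread_matching`). Conditioning on good orderings costs
a factor `2`. The kept blocks depend on the ordering in an uncontrolled way, so the clusters are
re-indexed by an independent uniform permutation `ρ`: the union bound over the `M ^ #I` possible
identities of the clusters concerned is paid for by the randomness of `ρ`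
(`card_slot_event_mul_le`). Finally, each prescribed vertex is placed either by the ordering or by
the matching, which gives `2 ^ s` cases (`exists_spread_law`). -/

theorem card_equiv_eq_on_le {X P W : Type*} [Fintype X] [Fintype P] [Fintype W]
    [DecidableEq P] [DecidableEq W]
    (ι : X ↪ P) (g : X → W) :
    #{σ : P ≃ W | (fun x => σ (ι x)) = g} ≤ (Fintype.card P - Fintype.card X)! := by
  rcases Finset.eq_empty_or_nonempty {σ : P ≃ W | (fun x => σ (ι x)) = g} with h | ⟨σ₀, hσ₀⟩
  · simp [h]
  have h₀ : ∀ x, σ₀ (ι x) = g x := fun x => congrFun (by simpa using hσ₀) x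
  -- The bijections that agree with `σ₀` on the range of `ι` correspond to the bijections between
  -- the two complements.
  let e₀ := σ₀.image (Set.range ι)
  have hc := Fintype.card_congr (Equiv.Set.compl e₀)
  have hs : Fintype.card ↥(Set.range ι)ᶜ = Fintype.card P - Fintype.card X := by
    rw [Fintype.card_compl_set, ← Set.toFinset_card, Set.toFinset_range,
      Finset.card_image_of_injective _ ι.injective, Finset.card_univ]
  have hle : #{σ : P ≃ W | (fun x => σ (ι x)) = g} ≤
      Fintype.card {e : P ≃ W // ∀ x : Set.range ι, e x = e₀ x} := by
    rw [Fintype.card_subtype]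
    refine Finset.card_le_card fun σ hσ => ?_
    simp only [Finset.mem_filter, Finset.mem_univ, true_and] at hσ ⊢
    rintro ⟨_, x, rfl⟩
    exact (congrFun hσ x).trans (h₀ x).symm
  refine hle.trans ?_
  rw [hc]
  rcases isEmpty_or_nonempty (↥(Set.range ι)ᶜ ≃ ↥(σ₀ '' Set.range ι)ᶜ) with h | ⟨⟨e⟩⟩
  · simp
  · rw [Fintype.card_equiv e, hs]

/-- The number of bijections whose restriction along `ι` lies in `A`. -/
theorem card_equiv_restrict_mem_le {X P W : Type*} [Fintype X] [Fintype P] [Fintype W]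
    [DecidableEq P] [DecidableEq W]
    (ι : X ↪ P) (A : Finset (X → W)) :
    #{σ : P ≃ W | (fun x => σ (ι x)) ∈ A} ≤ #A * (Fintype.card P - Fintype.card X)! := by
  rw [mul_comm]
  refine Finset.card_le_mul_card_image_of_maps_to (f := fun σ : P ≃ W => fun x => σ (ι x))
    (t := A) (fun σ hσ => by simpa using hσ) _ fun g _ => ?_
  refine le_trans (Finset.card_le_card fun σ hσ => ?_) (card_equiv_eq_on_le ι g)
  simp only [Finset.mem_filter, Finset.mem_univ, true_and] at hσ ⊢
  exact hσ.2

/-- The number of permutations prescribed on `I` up to an injective relabelling. -/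
theorem card_perm_comp_eq_on_le {N M : ℕ} (e : Fin N ↪ Fin M) (I : Finset (Fin N))
    (β : I → Fin M) :
    #{ρ : Equiv.Perm (Fin N) | ∀ i : I, e (ρ i) = β i} ≤ (N - #I)! := by
  rcases Finset.eq_empty_or_nonempty
    {ρ : Equiv.Perm (Fin N) | ∀ i : I, e (ρ i) = β i} with h | ⟨ρ₀, hρ₀⟩
  · rw [h]
    simp
  have h := card_equiv_eq_on_le (W := Fin N) (Function.Embedding.subtype (· ∈ I)) (fun i => ρ₀ i)
  simp only [Fintype.card_fin, Fintype.card_coe] at h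
  refine le_trans (Finset.card_le_card fun ρ hρ => ?_) h
  simp only [Finset.mem_filter, Finset.mem_univ, true_and] at hρ hρ₀ ⊢
  funext i
  exact e.injective ((hρ i).trans (hρ₀ i).symm)

/-- The number of bijections mapping positions from the sets `Q l` to the vertices `y l`. -/
theorem card_equiv_symm_mem_le {L P W : Type*} [Fintype L] [Fintype P] [Fintype W]
    [DecidableEq P] [DecidableEq W]
    (y : L ↪ W) (Q : L → Finset P) (b : ℕ) (hQ : ∀ l, #(Q l) ≤ b) :
    #{σ : P ≃ W | ∀ l, σ.symm (y l) ∈ Q l} ≤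
      b ^ Fintype.card L * (Fintype.card W - Fintype.card L)! := by
  have h := card_equiv_restrict_mem_le (W := P) y (Fintype.piFinset Q)
  have h2 : #{σ : P ≃ W | ∀ l, σ.symm (y l) ∈ Q l} ≤
      #{σ : W ≃ P | (fun x => σ (y x)) ∈ Fintype.piFinset Q} := by
    refine Finset.card_le_card_of_injOn Equiv.symm (fun σ hσ => ?_)
      (Equiv.symm_bijective.injective.injOn)
    simpa using hσ
  refine (h2.trans h).trans (Nat.mul_le_mul_right _ ?_)
  rw [Fintype.card_piFinset]
  refine (Finset.prod_le_prod' fun l _ => hQ l).trans ?_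
  simp

/-! ### Factorial estimates -/

/-- Comparing falling factorials factor by factor, `n (s - r) ≤ s (n - r)`, gives `n^s s! ≤ s^s
n(n-1)⋯(n-s+1)`, and `s^s ≤ e^s s!`. No smallness of `s` is needed, which matters because spreadness
concerns sequences of any length. -/
theorem pow_mul_factorial_sub_le (n s : ℕ) (hs : s ≤ n) :
    (n : ℝ) ^ s * ((n - s)! : ℝ) ≤ Real.exp 1 ^ s * (n ! : ℝ) := by
  have h1 : ∀ r : ℕ, r ≤ s → (n : ℝ) ^ r * (s.descFactorial r : ℝ) ≤
      (s : ℝ) ^ r * (n.descFactorial r : ℝ) := by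
    intro r
    induction r with
    | zero => simp
    | succ r ih =>
      intro hr
      have ih := ih (by omega)
      rw [Nat.descFactorial_succ, Nat.descFactorial_succ]
      push_cast [Nat.cast_sub (show r ≤ s by omega), Nat.cast_sub (show r ≤ n by omega)]
      have h2 : (n : ℝ) * (s - r) ≤ s * (n - r) := by
        have : (s : ℝ) ≤ n := by exact_mod_cast hs
        have : (0 : ℝ) ≤ r := by positivity
        nlinarith
      have h3 : (0 : ℝ) ≤ s - r := by
        have : ((r + 1 : ℕ) : ℝ) ≤ s := by exact_mod_cast hr
        push_cast at this; linarith
      calc (n : ℝ) ^ (r + 1) * ((s - r) * (s.descFactorial r : ℝ))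
          = (n * (s - r)) * (n ^ r * (s.descFactorial r : ℝ)) := by ring
        _ ≤ (s * (n - r)) * (s ^ r * (n.descFactorial r : ℝ)) := by
            apply mul_le_mul h2 ih (by positivity)
            exact le_trans (by positivity) h2
        _ = _ := by ring
  have h2 := h1 s le_rfl
  rw [Nat.descFactorial_self] at h2
  have h3 := Real.pow_div_factorial_le_exp (s : ℝ) (by positivity) s
  rw [div_le_iff₀ (by positivity)] at h3
  have h4 : (n : ℝ) ^ s ≤ Real.exp 1 ^ s * n.descFactorial s := by
    have h5 : (n : ℝ) ^ s * (s ! : ℝ) ≤ (Real.exp 1 ^ s * n.descFactorial s) * (s ! : ℝ) := by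
      refine h2.trans ?_
      rw [← Real.exp_nat_mul, mul_one]
      calc _ ≤ Real.exp s * (s ! : ℝ) * (n.descFactorial s : ℝ) := by gcongr
        _ = _ := by ring
    exact le_of_mul_le_mul_right h5 (by positivity)
  have h6 : (n ! : ℝ) = ((n - s)! : ℝ) * n.descFactorial s := by
    exact_mod_cast (Nat.factorial_mul_descFactorial hs).symm
  rw [h6]
  calc _ ≤ (Real.exp 1 ^ s * n.descFactorial s) * ((n - s)! : ℝ) := by gcongr
    _ = _ := by ring

/-- Bernoulli's inequality gives `(1 - xc/n)^c ≥ 1/2`, so sampling without replacement costs only a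
factor `2` for each of the `x` blocks. A loss of `e^c` per block would swamp the gain `c^(-6)`. -/
theorem pow_mul_factorial_sub_mul_le (n x c : ℕ) (h : 2 * x * c ^ 2 ≤ n) :
    (n : ℝ) ^ (x * c) * ((n - x * c)! : ℝ) ≤ 2 ^ x * (n ! : ℝ) := by
  rcases Nat.eq_zero_or_pos c with rfl | hc
  · simp only [mul_zero, pow_zero, one_mul, Nat.sub_zero]
    exact le_mul_of_one_le_left (by positivity) (one_le_pow₀ (by norm_num))
  rcases Nat.eq_zero_or_pos n with rfl | hn
  · have : x = 0 := by
      by_contra hx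
      have : 0 < 2 * x * c ^ 2 := by positivity
      omega
    simp [this]
  have hr : x * c ≤ n := by nlinarith
  have h1 : (1 / 2 : ℝ) ≤ (1 + -((x * c : ℝ) / n)) ^ c := by
    have hb := one_add_mul_le_pow (a := -((x * c : ℝ) / n)) (by
      have : (x * c : ℝ) / n ≤ 1 := by
        rw [div_le_one (by positivity)]; exact_mod_cast hr
      linarith) c
    refine le_trans ?_ hb
    have : (c : ℝ) * ((x * c : ℝ) / n) ≤ 1 / 2 := by
      rw [← mul_div_assoc, div_le_iff₀ (by positivity)]
      have : (2 * x * c ^ 2 : ℝ) ≤ n := by exact_mod_cast h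
      nlinarith
    linarith
  have h2 : ((n : ℝ) ^ c) ≤ 2 * ((n - x * c : ℕ) : ℝ) ^ c := by
    have e : ((n - x * c : ℕ) : ℝ) = n * (1 + -((x * c : ℝ) / n)) := by
      push_cast [Nat.cast_sub hr]
      field_simp
      ring
    rw [e, mul_pow]
    have : (0 : ℝ) < (n : ℝ) ^ c := by positivity
    nlinarith
  have h3 : ((n - x * c : ℕ) : ℝ) ^ (x * c) ≤ n.descFactorial (x * c) := by
    have := Nat.pow_sub_le_descFactorial n (x * c)
    exact_mod_cast (Nat.pow_le_pow_left (by omega) _).trans this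
  have h6 : (n ! : ℝ) = ((n - x * c)! : ℝ) * n.descFactorial (x * c) := by
    exact_mod_cast (Nat.factorial_mul_descFactorial hr).symm
  rw [h6]
  calc (n : ℝ) ^ (x * c) * ((n - x * c)! : ℝ)
      = (n ^ c) ^ x * ((n - x * c)! : ℝ) := by rw [← pow_mul, mul_comm c x]
    _ ≤ (2 * ((n - x * c : ℕ) : ℝ) ^ c) ^ x * ((n - x * c)! : ℝ) := by gcongr
    _ = 2 ^ x * (((n - x * c : ℕ) : ℝ) ^ (x * c)) * ((n - x * c)! : ℝ) := by
        rw [mul_pow, ← pow_mul, mul_comm c x]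
    _ ≤ 2 ^ x * (n.descFactorial (x * c)) * ((n - x * c)! : ℝ) := by gcongr
    _ = _ := by ring

/-- `binom(N, x) ≤ (e N / x) ^ x`. -/
theorem choose_mul_pow_le (N x : ℕ) :
    (N.choose x : ℝ) * (x : ℝ) ^ x ≤ (Real.exp 1 * N) ^ x := by
  have h1 := Nat.choose_le_pow_div (α := ℝ) x N
  have h3 := Real.pow_div_factorial_le_exp (x : ℝ) (by positivity) x
  calc (N.choose x : ℝ) * (x : ℝ) ^ x ≤ (N : ℝ) ^ x / x ! * (x : ℝ) ^ x := by gcongr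
    _ = (N : ℝ) ^ x * ((x : ℝ) ^ x / x !) := by ring
    _ ≤ (N : ℝ) ^ x * Real.exp x := by gcongr
    _ = _ := by rw [mul_pow, ← Real.exp_nat_mul, mul_one, mul_comm]

/-! ### Concentration of the number of hyperedges in a random sample -/

theorem card_enumerations {W : Type*} [Fintype W] {l : ℕ} (Z : Finset W) (hZ : #Z = l) :
    #{x : Fin l → W | univ.image x = Z} = l ! := by
  have hE : Fintype.card (Fin l ≃ Z) = l ! := by
    rw [Fintype.card_equiv ((Fintype.equivFinOfCardEq (by simpa using hZ)).symm), Fintype.card_fin]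
  rw [← hE, ← Finset.card_univ]
  symm
  refine Finset.card_bij (fun σ _ i => (σ i : W)) (fun σ _ => ?_) (fun σ _ τ _ h => ?_)
    fun x hx => ?_
  · simp only [Finset.mem_filter, Finset.mem_univ, true_and]
    ext w
    simp only [Finset.mem_image, Finset.mem_univ, true_and]
    refine ⟨?_, fun hw => ⟨σ.symm ⟨w, hw⟩, by simp⟩⟩
    rintro ⟨i, rfl⟩
    exact (σ i).2
  · ext i
    exact congrFun h i
  · simp only [Finset.mem_filter, Finset.mem_univ, true_and] at hx
    have hm : ∀ i, x i ∈ Z := fun i => hx ▸ Finset.mem_image_of_mem x (Finset.mem_univ i)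
    have hb : Function.Bijective fun i => (⟨x i, hm i⟩ : Z) := by
      rw [Fintype.bijective_iff_surjective_and_card]
      refine ⟨?_, by simp [hZ]⟩
      rintro ⟨w, hw⟩
      rw [← hx] at hw
      obtain ⟨i, -, rfl⟩ := Finset.mem_image.1 hw
      exact ⟨i, rfl⟩
    exact ⟨Equiv.ofBijective _ hb, Finset.mem_univ _, rfl⟩

/-- Independence of disjoint groups of coordinates: the expectation of the product factorises, and
the `r` leftover coordinates are free. -/
theorem sum_prod_blocks {ι W : Type*} [Fintype ι] [Fintype W] {B l r : ℕ}
    (e : ι ≃ (Fin B × Fin l) ⊕ Fin r) (h : (Fin l → W) → ℝ) :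
    ∑ g : ι → W, ∏ i : Fin B, h (fun j => g (e.symm (Sum.inl (i, j)))) =
      (Fintype.card W : ℝ) ^ r * (∑ x, h x) ^ B := by
  let E : (ι → W) ≃ (Fin B → Fin l → W) × (Fin r → W) :=
    (Equiv.arrowCongr e (Equiv.refl W)).trans
      ((Equiv.sumArrowEquivProdArrow _ _ _).trans
        (Equiv.prodCongr (Equiv.curry _ _ _) (Equiv.refl _)))
  have : ∀ g : ι → W, ∏ i : Fin B, h (fun j => g (e.symm (Sum.inl (i, j)))) =
      ∏ i : Fin B, h ((E g).1 i) := fun g => rfl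
  simp_rw [this]
  rw [Equiv.sum_comp E (fun p => ∏ i : Fin B, h (p.1 i)), Fintype.sum_prod_type, Fintype.sum_pow,
    Finset.mul_sum]
  refine Finset.sum_congr rfl fun p _ => ?_
  simp

/-- If a random `l`-tuple satisfies `F` with probability at least `q`, then a random sample `g`
satisfies `F` on fewer than an `a`-fraction of its `l`-subsets with exponentially small
probability. -/
theorem card_sparse_samples_le {ι W : Type*} [Fintype ι] [Fintype W] {l B : ℕ}
    (hB : B * l ≤ Fintype.card ι) (hl : l ≤ Fintype.card ι)
    (F : Finset W → Prop) (q a lam : ℝ) (hlam : 0 ≤ lam)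
    (hq : q * (Fintype.card W : ℝ) ^ l ≤ #{x : Fin l → W | F (univ.image x)}) :
    (#{g : ι → W | (#{Z ∈ powersetCard l (univ : Finset ι) | F (Z.image g)} : ℝ) ≤
        a * (Fintype.card ι).choose l} : ℝ) ≤
      (Fintype.card W : ℝ) ^ Fintype.card ι *
        Real.exp (B * (lam * a - q * (1 - Real.exp (-lam)))) := by
  set b := Fintype.card ι with hb
  set n := Fintype.card W with hn
  let e : ι ≃ (Fin B × Fin l) ⊕ Fin (b - B * l) := Fintype.equivOfCardEq (by simp; omega)
  let j : Fin B → Fin l ↪ ι := fun i =>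
    ⟨fun r => e.symm (Sum.inl (i, r)), fun r r' h => by simpa using h⟩
  let X : Equiv.Perm ι → (ι → W) → ℕ := fun ψ g =>
    #{i : Fin B | F (univ.image fun r => g (ψ (j i r)))}
  let deg : (ι → W) → ℕ := fun g => #{Z ∈ powersetCard l (univ : Finset ι) | F (Z.image g)}
  -- Hoeffding's device: for a random `ψ`, each of the `B` groups is a uniformly random `l`-subset
  -- of the coordinates, so the average of `X ψ g` is governed by `deg g`. An `l`-set arises from at
  -- most `l! (b - l)!` permutations.
  have hA : ∀ g, ∑ ψ, X ψ g ≤ B * (deg g * (l ! * (b - l)!)) := by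
    intro g
    have h1 : ∀ i : Fin B, #{ψ : Equiv.Perm ι | F (univ.image fun r => g (ψ (j i r)))} ≤
        deg g * (l ! * (b - l)!) := by
      intro i
      rw [mul_comm]
      refine Finset.card_le_mul_card_image_of_maps_to
        (f := fun ψ : Equiv.Perm ι => univ.image fun r => ψ (j i r)) (fun ψ hψ => ?_) _
        fun Z hZ => ?_
      · simp only [Finset.mem_filter, Finset.mem_univ, true_and,
          Finset.mem_powersetCard, Finset.subset_univ] at hψ ⊢
        refine ⟨?_, by rwa [Finset.image_image]⟩
        exact (Finset.card_image_of_injective (f := fun r => ψ (j i r)) _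
          (ψ.injective.comp (j i).injective)).trans (by simp)
      · simp only [Finset.mem_filter, Finset.mem_powersetCard] at hZ
        have h2 := card_equiv_restrict_mem_le (W := ι) (j i)
          {x : Fin l → ι | univ.image x = Z}
        rw [card_enumerations Z hZ.1.2, Fintype.card_fin] at h2
        refine le_trans (Finset.card_le_card fun ψ hψ => ?_) h2
        simp only [Finset.mem_filter, Finset.mem_univ, true_and] at hψ ⊢
        exact hψ.2
    calc ∑ ψ, X ψ g
        = ∑ i : Fin B, #{ψ : Equiv.Perm ι | F (univ.image fun r => g (ψ (j i r)))} := by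
          simp only [X, Finset.card_filter]
          exact Finset.sum_comm
      _ ≤ ∑ i : Fin B, deg g * (l ! * (b - l)!) := Finset.sum_le_sum fun i _ => h1 i
      _ = _ := by simp
  have hperm : (Fintype.card (Equiv.Perm ι) : ℝ) = (b ! : ℝ) := by
    rw [Fintype.card_perm]
  -- For a sparse sample the average of `X ψ g` over `ψ` is at most `a B`; convexity, in the form `1
  -- + y ≤ exp y`, makes the average of `exp (-lam (X ψ g - a B))` at least `1`.
  have hBad : ∀ g, (deg g : ℝ) ≤ a * b.choose l →
      (b ! : ℝ) ≤ ∑ ψ : Equiv.Perm ι, Real.exp (-lam * (X ψ g - a * B)) := by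
    intro g hg
    have h1 : (∑ ψ, (X ψ g : ℝ)) ≤ a * B * b ! := by
      have h2 : (∑ ψ, (X ψ g : ℝ)) ≤ B * (deg g * (l ! * (b - l)!)) := by exact_mod_cast hA g
      refine h2.trans ?_
      have h3 : (b ! : ℝ) = b.choose l * (l ! * (b - l)!) := by
        rw [← mul_assoc]
        exact_mod_cast (Nat.choose_mul_factorial_mul_factorial hl).symm
      rw [h3]
      calc (B : ℝ) * (deg g * (l ! * (b - l)!))
          ≤ B * ((a * b.choose l) * (l ! * (b - l)!)) := by gcongr
        _ = _ := by ring
    calc (b ! : ℝ) ≤ (b ! : ℝ) - lam * ((∑ ψ, (X ψ g : ℝ)) - a * B * (b ! : ℝ)) := by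
          have : 0 ≤ lam * (a * B * (b ! : ℝ) - ∑ ψ, (X ψ g : ℝ)) := mul_nonneg hlam (by linarith)
          linarith
      _ = ∑ ψ : Equiv.Perm ι, (-lam * (X ψ g - a * B) + 1) := by
          rw [Finset.sum_add_distrib, ← Finset.mul_sum, Finset.sum_sub_distrib]
          simp only [Finset.sum_const, Finset.card_univ, nsmul_eq_mul, hperm]
          ring
      _ ≤ _ := Finset.sum_le_sum fun ψ _ => Real.add_one_le_exp _
  let h : (Fin l → W) → ℝ := fun x => if F (univ.image x) then Real.exp (-lam) else 1
  have hX : ∀ g, Real.exp (-lam * X 1 g) =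
      ∏ i : Fin B, h (fun r => g (e.symm (Sum.inl (i, r)))) := by
    intro g
    simp only [h, Finset.prod_ite, Finset.prod_const_one, mul_one, Finset.prod_const]
    rw [← Real.exp_nat_mul, mul_comm]
    rfl
  -- Permuting the coordinates preserves the uniform measure on samples, so only the fixed grouping
  -- given by `ψ = 1` has to be computed.
  have hshift : ∀ ψ : Equiv.Perm ι, ∑ g : ι → W, Real.exp (-lam * X ψ g) =
      ∑ g : ι → W, Real.exp (-lam * X 1 g) := by
    intro ψ
    exact Equiv.sum_comp (Equiv.arrowCongr ψ.symm (Equiv.refl W))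
      (fun g => Real.exp (-lam * X 1 g))
  have hsum : (∑ x, h x) ≤ (n : ℝ) ^ l * Real.exp (-q * (1 - Real.exp (-lam))) := by
    have h1 : (∑ x, h x) =
        (n : ℝ) ^ l - #{x : Fin l → W | F (univ.image x)} * (1 - Real.exp (-lam)) := by
      have h2 : ∀ x, h x = 1 - (if F (univ.image x) then 1 else 0) * (1 - Real.exp (-lam)) := by
        intro x
        simp only [h]
        split_ifs <;> ring
      simp_rw [h2]
      rw [Finset.sum_sub_distrib, ← Finset.sum_mul, Finset.sum_boole]
      simp [hn]
    have h3 : 0 ≤ 1 - Real.exp (-lam) := by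
      have : Real.exp (-lam) ≤ 1 := Real.exp_le_one_iff.2 (by linarith)
      linarith
    calc (∑ x, h x) ≤ (n : ℝ) ^ l - (q * (n : ℝ) ^ l) * (1 - Real.exp (-lam)) := by
          rw [h1]; gcongr
      _ = (n : ℝ) ^ l * (-q * (1 - Real.exp (-lam)) + 1) := by ring
      _ ≤ _ := by gcongr; exact Real.add_one_le_exp _
  have hh : ∀ x, 0 ≤ h x := fun x => by simp only [h]; split_ifs <;> positivity
  have htot : ∑ g : ι → W, Real.exp (-lam * X 1 g) ≤
      (n : ℝ) ^ b * Real.exp (B * (-q * (1 - Real.exp (-lam)))) := by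
    simp_rw [hX]
    rw [sum_prod_blocks e h]
    calc (n : ℝ) ^ (b - B * l) * (∑ x, h x) ^ B
        ≤ (n : ℝ) ^ (b - B * l) *
          ((n : ℝ) ^ l * Real.exp (-q * (1 - Real.exp (-lam)))) ^ B := by
          gcongr
      _ = ((n : ℝ) ^ (b - B * l) * (n : ℝ) ^ (B * l)) *
          Real.exp (B * (-q * (1 - Real.exp (-lam)))) := by
          rw [mul_pow, ← pow_mul, mul_comm l B, Real.exp_nat_mul, mul_assoc]
      _ = _ := by rw [← pow_add, Nat.sub_add_cancel hB]
  set S : Finset (ι → W) := {g | (deg g : ℝ) ≤ a * b.choose l} with hS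
  have hmain : (#S : ℝ) * b ! ≤ b ! * ((n : ℝ) ^ b *
      Real.exp (B * (lam * a - q * (1 - Real.exp (-lam))))) := by
    calc (#S : ℝ) * b ! = ∑ g ∈ S, (b ! : ℝ) := by simp
      _ ≤ ∑ g ∈ S, ∑ ψ : Equiv.Perm ι, Real.exp (-lam * (X ψ g - a * B)) :=
          Finset.sum_le_sum fun g hg => hBad g (by simpa [hS] using hg)
      _ ≤ ∑ g, ∑ ψ : Equiv.Perm ι, Real.exp (-lam * (X ψ g - a * B)) :=
          Finset.sum_le_sum_of_subset_of_nonneg (Finset.subset_univ _) fun g _ _ =>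
            Finset.sum_nonneg fun ψ _ => (Real.exp_pos _).le
      _ = ∑ ψ : Equiv.Perm ι, Real.exp (lam * a * B) * ∑ g, Real.exp (-lam * X ψ g) := by
          rw [Finset.sum_comm]
          refine Finset.sum_congr rfl fun ψ _ => ?_
          rw [Finset.mul_sum]
          refine Finset.sum_congr rfl fun g _ => ?_
          rw [← Real.exp_add]
          ring_nf
      _ = b ! * (Real.exp (lam * a * B) * ∑ g, Real.exp (-lam * X 1 g)) := by
          simp_rw [hshift]
          rw [Finset.sum_const, Finset.card_univ, nsmul_eq_mul, hperm]
      _ ≤ b ! * (Real.exp (lam * a * B) *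
          ((n : ℝ) ^ b * Real.exp (B * (-q * (1 - Real.exp (-lam)))))) := by gcongr
      _ = _ := by
          rw [mul_left_comm (Real.exp (lam * a * B)), ← Real.exp_add]
          congr 3
          ring
  rw [mul_comm] at hmain
  exact le_of_mul_le_mul_left hmain (by positivity)

/-! ### Spread perfect matchings in dense bipartite graphs -/

theorem card_piFinset_filter_le {X Y : Type*} [Fintype X] [DecidableEq X] [DecidableEq Y]
    (nbr : X → Finset Y) (Z : Finset X)
    (B : X → Finset Y) (w : ℝ) (hw : ∀ x ∈ Z, (#(nbr x ∩ B x) : ℝ) ≤ w * #(nbr x)) :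
    (#{a ∈ Fintype.piFinset nbr | ∀ x ∈ Z, a x ∈ B x} : ℝ) ≤
      w ^ #Z * #(Fintype.piFinset nbr) := by
  have h1 : ({a ∈ Fintype.piFinset nbr | ∀ x ∈ Z, a x ∈ B x} : Finset (X → Y)) =
      Fintype.piFinset fun x => if x ∈ Z then nbr x ∩ B x else nbr x := by
    ext a
    simp only [Finset.mem_filter, Fintype.mem_piFinset]
    constructor
    · rintro ⟨h, h'⟩ x
      split_ifs with hx
      · exact Finset.mem_inter.2 ⟨h x, h' x hx⟩
      · exact h x
    · intro h
      refine ⟨fun x => ?_, fun x hx => ?_⟩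
      · have := h x
        split_ifs at this
        · exact (Finset.mem_inter.1 this).1
        · exact this
      · have := h x
        rw [if_pos hx] at this
        exact (Finset.mem_inter.1 this).2
  rw [h1, Fintype.card_piFinset, Fintype.card_piFinset]
  push_cast
  have h2 : w ^ #Z = ∏ x : X, if x ∈ Z then w else 1 := by
    simp
  rw [h2, ← Finset.prod_mul_distrib]
  refine Finset.prod_le_prod (fun x _ => by positivity) fun x _ => ?_
  split_ifs with hx
  · exact hw x hx
  · simp

/-- The number of random neighbours picked by each vertex. -/
abbrev picks : ℕ := 20

/-- The bipartite graph spanned by the picked edges. -/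
def PickedEdge {N : ℕ} (a : Bool × Fin N × Fin picks → Fin N) (i j : Fin N) : Prop :=
  ∃ r, a (true, i, r) = j ∨ a (false, j, r) = i

/-- A violator of Hall's condition that is too large is replaced by a violator on the other side.
Restricting to at most half of the vertices keeps the ratio of `#T` to `3N/4` at most `2/3`, so that
the picks make the event unlikely. -/
theorem exists_hall_obstruction {N : ℕ} (a : Bool × Fin N × Fin picks → Fin N)
    (h : ¬ ∃ π : Equiv.Perm (Fin N), ∀ i, PickedEdge a i (π i)) :
    ∃ (s : Bool) (S T : Finset (Fin N)), #S = #T + 1 ∧ 2 * #S ≤ N + 1 ∧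
      ∀ i ∈ S, ∀ r, a (s, i, r) ∈ T := by
  have hall := Finset.all_card_le_biUnion_card_iff_exists_injective
    (fun i : Fin N => ({j | PickedEdge a i j} : Finset (Fin N)))
  have hn : ¬ ∀ s : Finset (Fin N), #s ≤ #(s.biUnion fun i => {j | PickedEdge a i j}) := by
    intro hs
    obtain ⟨f, hf, hf'⟩ := hall.1 hs
    exact h ⟨Equiv.ofBijective f (Finite.injective_iff_bijective.1 hf), fun i => by
      simpa using hf' i⟩
  push Not at hn
  obtain ⟨S, hS⟩ := hn
  set R : Finset (Fin N) := S.biUnion fun i => {j | PickedEdge a i j} with hR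
  have hSN : #S ≤ N := by simpa using Finset.card_le_univ S
  by_cases hc : 2 * #S ≤ N + 1
  · obtain ⟨T, hT, -, hT'⟩ := Finset.exists_subsuperset_card_eq (Finset.subset_univ R)
      (n := #S - 1) (by omega) (by simp; omega)
    refine ⟨true, S, T, by omega, hc, fun i hi r => hT ?_⟩
    rw [hR, Finset.mem_biUnion]
    exact ⟨i, hi, by simpa using ⟨r, Or.inl rfl⟩⟩
  -- Vertices outside the neighbourhood `R` of `S` have all their picks in `Sᶜ`, and there are more
  -- than `#Sᶜ` of them.
  · have hRc : #Rᶜ = N - #R := by simp [Finset.card_compl]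
    obtain ⟨S', -, hS', hS''⟩ := Finset.exists_subsuperset_card_eq (Finset.empty_subset Rᶜ)
      (n := N - #S + 1) (by simp) (by omega)
    refine ⟨false, S', Sᶜ, by simp [Finset.card_compl, hS''], by omega, fun j hj r => ?_⟩
    rw [Finset.mem_compl]
    intro hmem
    refine (Finset.mem_compl.1 (hS' hj)) ?_
    rw [hR, Finset.mem_biUnion]
    exact ⟨_, hmem, by simpa using ⟨r, Or.inr rfl⟩⟩

theorem choose_mul_choose_mul_le {N u : ℕ} (hu : 2 * u ≤ N) (hN : 0 < N) :
    ((N.choose (u + 1) : ℝ) * N.choose u) * (4 * u / (3 * N)) ^ (picks * (u + 1)) ≤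
      1 / 8 * (1 / 2) ^ u := by
  rcases Nat.eq_zero_or_pos u with rfl | hu0
  -- For `u = 0` the power of `0` vanishes: a vertex cannot have all its picks in the empty set.
  · simp [picks]
  have huR : (0 : ℝ) < u := by exact_mod_cast hu0
  have hNR : (0 : ℝ) < N := by exact_mod_cast hN
  have hz : (u : ℝ) / N ≤ 1 / 2 := by
    rw [div_le_div_iff₀ hNR (by norm_num)]
    have : (2 * u : ℝ) ≤ N := by exact_mod_cast hu
    linarith
  have h1 : (N.choose (u + 1) : ℝ) ≤ (Real.exp 1 * N / u) ^ (u + 1) := by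
    rw [div_pow, le_div_iff₀ (by positivity)]
    refine le_trans ?_ (choose_mul_pow_le N (u + 1))
    push_cast
    gcongr
    linarith
  have h2 : (N.choose u : ℝ) ≤ (Real.exp 1 * N / u) ^ (u + 1) := by
    have h3 : (N.choose u : ℝ) ≤ (Real.exp 1 * N / u) ^ u := by
      rw [div_pow, le_div_iff₀ (by positivity)]
      exact choose_mul_pow_le N u
    refine h3.trans (pow_le_pow_right₀ ?_ (by omega))
    rw [le_div_iff₀ huR]
    have h4 : (u : ℝ) ≤ N := by exact_mod_cast (show u ≤ N by omega)
    have h5 := Real.add_one_le_exp (1 : ℝ)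
    nlinarith
  -- The two binomials consume two of the 20 factors `4u/(3N)`; the other 18 are at most `2/3` each,
  -- which beats the constant `16 e²/9`.
  have h3 : (Real.exp 1 * N / u) * (Real.exp 1 * N / u) * (4 * u / (3 * N)) ^ picks ≤ 1 / 8 := by
    have h4 : (Real.exp 1 * N / u) * (Real.exp 1 * N / u) * (4 * u / (3 * N)) ^ picks =
        Real.exp 1 ^ 2 * (16 / 9) * (4 / 3 * (u / N)) ^ 18 := by
      simp only [picks]
      field_simp
      norm_num
    rw [h4]
    have h5 : Real.exp 1 ^ 2 ≤ 9 := by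
      have := Real.exp_one_lt_d9
      have h0 := Real.exp_pos 1
      nlinarith
    calc Real.exp 1 ^ 2 * (16 / 9) * (4 / 3 * ((u : ℝ) / N)) ^ 18
        ≤ 9 * (16 / 9) * (4 / 3 * (1 / 2)) ^ 18 := by gcongr
      _ ≤ 1 / 8 := by norm_num
  calc ((N.choose (u + 1) : ℝ) * N.choose u) * (4 * u / (3 * N)) ^ (picks * (u + 1))
      ≤ ((Real.exp 1 * N / u) ^ (u + 1) * (Real.exp 1 * N / u) ^ (u + 1)) *
        (4 * u / (3 * N)) ^ (picks * (u + 1)) := by gcongr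
    _ = ((Real.exp 1 * N / u) * (Real.exp 1 * N / u) * (4 * u / (3 * N)) ^ picks) ^ (u + 1) := by
        rw [pow_mul, mul_pow, mul_pow]
    _ ≤ (1 / 8) ^ (u + 1) := by gcongr
    _ = 1 / 8 * (1 / 8) ^ u := by rw [pow_succ, mul_comm]
    _ ≤ _ := by gcongr; norm_num

/-- The admissible picks of a vertex on either side of the bipartite graph `G`. -/
noncomputable def nbrs {N : ℕ} (G : Fin N → Fin N → Prop) (x : Bool × Fin N × Fin picks) :
    Finset (Fin N) :=
  if x.1 then univ.filter fun j => G x.2.1 j else univ.filter fun i => G i x.2.1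

section

variable {N : ℕ} {G : Fin N → Fin N → Prop}
  (hrow : ∀ i, 3 * N ≤ 4 * #{j | G i j}) (hcol : ∀ j, 3 * N ≤ 4 * #{i | G i j})

include hrow hcol

theorem le_card_nbrs (x : Bool × Fin N × Fin picks) : 3 * N ≤ 4 * #(nbrs G x) := by
  unfold nbrs
  split_ifs
  · exact hrow _
  · exact hcol _

theorem card_piFinset_filter_nbrs_le (hN : 0 < N) (Z : Finset (Bool × Fin N × Fin picks))
    (B : Bool × Fin N × Fin picks → Finset (Fin N)) (u : ℕ) (hB : ∀ x ∈ Z, #(B x) ≤ u) :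
    (#{a ∈ Fintype.piFinset (nbrs G) | ∀ x ∈ Z, a x ∈ B x} : ℝ) ≤
      (4 * u / (3 * N)) ^ #Z * #(Fintype.piFinset (nbrs G)) := by
  refine card_piFinset_filter_le _ Z B _ fun x hx => ?_
  have h1 : (#(nbrs G x ∩ B x) : ℝ) ≤ u := by
    exact_mod_cast (Finset.card_le_card Finset.inter_subset_right).trans (hB x hx)
  refine h1.trans ?_
  have h2 : (3 * N : ℝ) ≤ 4 * #(nbrs G x) := by exact_mod_cast le_card_nbrs hrow hcol x
  have hNR : (0 : ℝ) < N := by exact_mod_cast hN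
  rw [div_mul_eq_mul_div, le_div_iff₀ (by positivity)]
  nlinarith [(Nat.cast_nonneg u : (0 : ℝ) ≤ u)]

/-- Union bound over the side and the pair `(S, T)` of a Hall obstruction with `#T = u`. The terms
are at most `(1/4) 2^(-u)` and sum to at most `1/2`. -/
theorem card_unmatched_le (hN : 0 < N) :
    (#{a ∈ Fintype.piFinset (nbrs G) |
      ¬ ∃ π : Equiv.Perm (Fin N), ∀ i, PickedEdge a i (π i)} : ℝ) ≤
      1 / 2 * #(Fintype.piFinset (nbrs G)) := by
  set Ω := Fintype.piFinset (nbrs G) with hΩ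
  let ev : Bool → Finset (Fin N) → Finset (Fin N) →
      Finset (Bool × Fin N × Fin picks → Fin N) := fun s S T =>
    {a ∈ Ω | ∀ x ∈ ({s} : Finset Bool) ×ˢ S ×ˢ (univ : Finset (Fin picks)), a x ∈ T}
  let U : Finset ℕ := (range N).filter fun u => 2 * u ≤ N
  have hsub : ({a ∈ Ω | ¬ ∃ π : Equiv.Perm (Fin N), ∀ i, PickedEdge a i (π i)} : Finset _) ⊆
      U.biUnion fun u => (univ ×ˢ powersetCard (u + 1) univ ×ˢ powersetCard u univ).biUnion
        fun p : Bool × Finset (Fin N) × Finset (Fin N) => ev p.1 p.2.1 p.2.2 := by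
    intro a ha
    rw [Finset.mem_filter] at ha
    obtain ⟨s, S, T, h1, h2, h3⟩ := exists_hall_obstruction a ha.2
    have hSN : #S ≤ N := by simpa using Finset.card_le_univ S
    simp only [Finset.mem_biUnion, Finset.mem_product, Finset.mem_powersetCard, U, ev,
      Finset.mem_filter, Finset.mem_range]
    refine ⟨#T, by omega, ⟨s, S, T⟩, by simp [h1], ha.1, ?_⟩
    rintro ⟨s', i, r⟩ ⟨hs', hi, -⟩
    obtain rfl := Finset.mem_singleton.1 hs'
    exact h3 i hi r
  have hev : ∀ u ∈ U, ∀ p ∈ (univ ×ˢ powersetCard (u + 1) univ ×ˢ powersetCard u univ :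
      Finset (Bool × Finset (Fin N) × Finset (Fin N))),
      (#(ev p.1 p.2.1 p.2.2) : ℝ) ≤ (4 * u / (3 * N)) ^ (picks * (u + 1)) * #Ω := by
    rintro u - ⟨s, S, T⟩ hp
    simp only [Finset.mem_product, Finset.mem_powersetCard] at hp
    refine (card_piFinset_filter_nbrs_le hrow hcol hN _ (fun _ => T) u
      (fun _ _ => hp.2.2.2.le)).trans_eq ?_
    congr 2
    simp [hp.2.1.2, mul_comm]
  have hcard : ∀ u, (#(univ ×ˢ powersetCard (u + 1) univ ×ˢ powersetCard u univ :
      Finset (Bool × Finset (Fin N) × Finset (Fin N))) : ℝ) =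
      2 * ((N.choose (u + 1) : ℝ) * N.choose u) := by
    intro u
    simp
  calc _ ≤ ((#(U.biUnion fun u =>
        (univ ×ˢ powersetCard (u + 1) univ ×ˢ powersetCard u univ).biUnion
        fun p : Bool × Finset (Fin N) × Finset (Fin N) => ev p.1 p.2.1 p.2.2) : ℕ) : ℝ) := by
        exact_mod_cast Finset.card_le_card hsub
    _ ≤ ∑ u ∈ U, ∑ p ∈ (univ ×ˢ powersetCard (u + 1) univ ×ˢ powersetCard u univ :
        Finset (Bool × Finset (Fin N) × Finset (Fin N))), (#(ev p.1 p.2.1 p.2.2) : ℝ) := by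
        exact_mod_cast Finset.card_biUnion_le.trans
          (Finset.sum_le_sum fun u _ => Finset.card_biUnion_le)
    _ ≤ ∑ u ∈ U, (2 * ((N.choose (u + 1) : ℝ) * N.choose u)) *
          ((4 * u / (3 * N)) ^ (picks * (u + 1)) * #Ω) := by
        refine Finset.sum_le_sum fun u hu => ?_
        rw [← hcard, ← nsmul_eq_mul]
        exact Finset.sum_le_card_nsmul _ _ _ (hev u hu)
    _ = ∑ u ∈ U, 2 * (((N.choose (u + 1) : ℝ) * N.choose u) *
          (4 * u / (3 * N)) ^ (picks * (u + 1))) * #Ω :=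
        Finset.sum_congr rfl fun u _ => by ring
    _ ≤ ∑ u ∈ U, 2 * (1 / 8 * (1 / 2 : ℝ) ^ u) * #Ω := by
        refine Finset.sum_le_sum fun u hu => ?_
        have := choose_mul_choose_mul_le (Finset.mem_filter.1 hu).2 hN
        gcongr
    _ ≤ ∑ u ∈ range N, 2 * (1 / 8 * (1 / 2 : ℝ) ^ u) * #Ω :=
        Finset.sum_le_sum_of_subset_of_nonneg (Finset.filter_subset _ _) fun u _ _ => by positivity
    _ = 1 / 4 * (∑ u ∈ range N, (1 / 2 : ℝ) ^ u) * #Ω := by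
        rw [Finset.mul_sum, Finset.sum_mul]
        exact Finset.sum_congr rfl fun u _ => by ring
    _ ≤ 1 / 4 * 2 * #Ω := by
        have := sum_geometric_two_le N
        gcongr
    _ = _ := by ring

/-- An edge can be picked from either end in one of 20 picks, hence 40 ways, each of probability at
most `4/(3N)`; and `160/3 ≤ 60`. -/
theorem card_picked_on_le (hN : 0 < N) (I : Finset (Fin N)) (g : Fin N → Fin N)
    (hg : Set.InjOn g I) :
    (#{a ∈ Fintype.piFinset (nbrs G) | ∀ i ∈ I, PickedEdge a i (g i)} : ℝ) ≤
      (60 / N) ^ #I * #(Fintype.piFinset (nbrs G)) := by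
  set Ω := Fintype.piFinset (nbrs G) with hΩ
  let pos : (I → Bool × Fin picks) → I → Bool × Fin N × Fin picks := fun c i =>
    ((c i).1, if (c i).1 then (i : Fin N) else g i, (c i).2)
  let B : Bool × Fin N × Fin picks → Finset (Fin N) := fun x =>
    if x.1 then {g x.2.1} else I.filter fun i => g i = x.2.1
  -- Injectivity of `g` on `I` makes the picks involved distinct, hence independent, whichever end
  -- each edge is picked from.
  have hpos : ∀ c, Function.Injective (pos c) := by
    intro c i i' h
    simp only [pos, Prod.mk.injEq] at h
    obtain ⟨h1, h2, -⟩ := h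
    rw [← h1] at h2
    by_cases hc : (c i).1 = true
    · simp only [hc, if_true] at h2
      exact Subtype.ext h2
    · simp only [hc] at h2
      exact Subtype.ext (hg i.2 i'.2 h2)
  have hB : ∀ x, #(B x) ≤ 1 := by
    intro x
    simp only [B]
    split_ifs
    · simp
    · refine Finset.card_le_one.2 fun i hi j hj => ?_
      rw [Finset.mem_filter] at hi hj
      exact hg hi.1 hj.1 (hi.2.trans hj.2.symm)
  have hsub : ({a ∈ Ω | ∀ i ∈ I, PickedEdge a i (g i)} : Finset _) ⊆
      (univ : Finset (I → Bool × Fin picks)).biUnion fun c =>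
        {a ∈ Ω | ∀ x ∈ univ.image (pos c), a x ∈ B x} := by
    intro a ha
    rw [Finset.mem_filter] at ha
    have hc : ∀ i : I, ∃ c : Bool × Fin picks,
        a (c.1, if c.1 then (i : Fin N) else g i, c.2) ∈
          B (c.1, if c.1 then (i : Fin N) else g i, c.2) := by
      rintro ⟨i, hi⟩
      obtain ⟨r, h | h⟩ := ha.2 i hi
      · exact ⟨(true, r), by simp [B, h]⟩
      · exact ⟨(false, r), by simp [B, h, hi]⟩
    choose c hc using hc
    simp only [Finset.mem_biUnion, Finset.mem_univ, true_and, Finset.mem_filter,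
      Finset.forall_mem_image]
    exact ⟨c, ha.1, fun i _ => hc i⟩
  have hev : ∀ c : I → Bool × Fin picks,
      (#{a ∈ Ω | ∀ x ∈ univ.image (pos c), a x ∈ B x} : ℝ) ≤ (4 / (3 * N)) ^ #I * #Ω := by
    intro c
    have h1 := card_piFinset_filter_nbrs_le hrow hcol hN (univ.image (pos c)) B 1 fun x _ => hB x
    rw [Finset.card_image_of_injective _ (hpos c)] at h1
    simpa only [Finset.card_univ, Fintype.card_coe, Nat.cast_one, mul_one] using h1
  calc _ ≤ ((#((univ : Finset (I → Bool × Fin picks)).biUnion fun c =>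
        {a ∈ Ω | ∀ x ∈ univ.image (pos c), a x ∈ B x}) : ℕ) : ℝ) := by
        exact_mod_cast Finset.card_le_card hsub
    _ ≤ ∑ c : I → Bool × Fin picks, (#{a ∈ Ω | ∀ x ∈ univ.image (pos c), a x ∈ B x} : ℝ) := by
        exact_mod_cast Finset.card_biUnion_le
    _ ≤ ∑ c : I → Bool × Fin picks, (4 / (3 * N)) ^ #I * (#Ω : ℝ) :=
        Finset.sum_le_sum fun c _ => hev c
    _ = (40 * (4 / (3 * N))) ^ #I * (#Ω : ℝ) := by
        rw [Finset.sum_const, Finset.card_univ, Fintype.card_fun, nsmul_eq_mul, mul_pow]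
        simp only [Fintype.card_prod, Fintype.card_bool, Fintype.card_fin, Fintype.card_coe, picks]
        push_cast
        ring
    _ ≤ _ := by
        have hNR : (0 : ℝ) < N := by exact_mod_cast hN
        gcongr
        rw [← mul_div_assoc, div_le_div_iff₀ (by positivity) hNR]
        nlinarith

/-- A dense balanced bipartite graph carries a spread distribution on its perfect matchings. -/
theorem exists_spread_matching (hN : 0 < N) :
    ∃ μ : PMF (Equiv.Perm (Fin N)), (∀ π ∈ μ.support, ∀ i, G i (π i)) ∧
      ∀ (I : Finset (Fin N)) (g : Fin N → Fin N),
        μ.toOuterMeasure {π | ∀ i ∈ I, π i = g i} ≤ ENNReal.ofReal (2 * (60 / N) ^ #I) := by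
  set Ω := Fintype.piFinset (nbrs G) with hΩ
  set good : Finset (Bool × Fin N × Fin picks → Fin N) :=
    {a ∈ Ω | ∃ π : Equiv.Perm (Fin N), ∀ i, PickedEdge a i (π i)} with hgood
  have hΩ0 : 0 < #Ω := by
    rw [Finset.card_pos, hΩ, Fintype.piFinset_nonempty]
    intro x
    rw [← Finset.card_pos]
    have := le_card_nbrs hrow hcol x
    omega
  have hhalf : (#Ω : ℝ) ≤ 2 * #good := by
    have h1 := card_unmatched_le hrow hcol hN
    have h2 := Finset.card_filter_add_card_filter_not (s := Ω)
      (fun a => ∃ π : Equiv.Perm (Fin N), ∀ i, PickedEdge a i (π i))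
    have h3 : (#good : ℝ) + #{a ∈ Ω | ¬ ∃ π : Equiv.Perm (Fin N), ∀ i, PickedEdge a i (π i)} =
        #Ω := by exact_mod_cast h2
    linarith
  have hΩR : (0 : ℝ) < #Ω := by exact_mod_cast hΩ0
  have hgR : (0 : ℝ) < #good := by linarith
  have hne : good.Nonempty := Finset.card_pos.1 (by exact_mod_cast hgR)
  let match' : (Bool × Fin N × Fin picks → Fin N) → Equiv.Perm (Fin N) := fun a =>
    if h : ∃ π : Equiv.Perm (Fin N), ∀ i, PickedEdge a i (π i) then h.choose else 1
  have hmatch : ∀ a ∈ good, ∀ i, PickedEdge a i (match' a i) := by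
    intro a ha
    have h := (Finset.mem_filter.1 ha).2
    simp only [match', dif_pos h]
    exact h.choose_spec
  refine ⟨(PMF.uniformOfFinset good hne).map match', ?_, ?_⟩
  · intro π hπ i
    rw [PMF.mem_support_map_iff] at hπ
    obtain ⟨a, ha, rfl⟩ := hπ
    rw [PMF.mem_support_uniformOfFinset_iff] at ha
    have hmem := Fintype.mem_piFinset.1 (Finset.mem_filter.1 ha).1
    obtain ⟨r, h | h⟩ := hmatch a ha i
    · have := hmem (true, i, r)
      rw [h] at this
      simpa [nbrs] using this
    · have := hmem (false, match' a i, r)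
      rw [h] at this
      simpa [nbrs] using this
  · intro I g
    rw [PMF.toOuterMeasure_map_apply, PMF.toOuterMeasure_uniformOfFinset_apply]
    by_cases hg : Set.InjOn g I
    · have h1 : #{a ∈ good | a ∈ match' ⁻¹' {π | ∀ i ∈ I, π i = g i}} ≤
          #{a ∈ Ω | ∀ i ∈ I, PickedEdge a i (g i)} := by
        refine Finset.card_le_card fun a ha => ?_
        simp only [Finset.mem_filter, Set.mem_preimage, Set.mem_ofPred_eq] at ha ⊢
        refine ⟨(Finset.mem_filter.1 ha.1).1, fun i hi => ?_⟩
        rw [← ha.2 i hi]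
        exact hmatch a ha.1 i
      have h2 := card_picked_on_le hrow hcol hN I g hg
      refine ENNReal.div_le_of_le_mul ?_
      rw [← ENNReal.ofReal_natCast, ← ENNReal.ofReal_natCast,
        ← ENNReal.ofReal_mul (by positivity)]
      refine ENNReal.ofReal_le_ofReal ?_
      calc _ ≤ (60 / (N : ℝ)) ^ #I * #Ω := le_trans (by exact_mod_cast h1) h2
        _ ≤ (60 / (N : ℝ)) ^ #I * (2 * #good) := by gcongr
        _ = _ := by ring
    -- No permutation agrees on `I` with a map that is not injective there.
    · have h1 : ({a ∈ good | a ∈ match' ⁻¹' {π | ∀ i ∈ I, π i = g i}} : Finset _) = ∅ := by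
        refine Finset.filter_eq_empty_iff.2 fun a _ ha => hg fun i hi j hj hij => ?_
        exact (match' a).injective (by rw [ha i hi, ha j hj, hij])
      rw [h1]
      simp

end

/-! ### Rich sets: samples of large relative minimum degree -/

/-- The number of `l`-subsets of `S` that complete `D` to an edge. -/
noncomputable def degIn {W : Type*} (E : Finset W → Prop) (l : ℕ) (D S : Finset W) : ℕ :=
  #{X ∈ powersetCard l S | E (D ∪ X)}

/-- `S` is rich with respect to `T`: all `d`-subsets of `S ∪ T` have large degree into `S`. -/
def Rich {W : Type*} (E : Finset W → Prop) (d l t : ℕ) (θ : ℝ) (T S : Finset W) : Prop :=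
  ∀ D ⊆ S ∪ T, #D = d → θ * ((#S + t + 1).choose l : ℝ) ≤ degIn E l D S

theorem Rich.mono {W : Type*} {E : Finset W → Prop} {d l t : ℕ} {θ : ℝ} {T T' S : Finset W}
    (h : Rich E d l t θ T S) (hT : T' ⊆ T) : Rich E d l t θ T' S :=
  fun D hD => h D (hD.trans (Finset.union_subset_union_right hT))

section

variable {W : Type*}

/-- The set of `d` vertices selected by `sel` among the sample `g` and the fixed set `T`. -/
noncomputable def selected {c d : ℕ} {T : Finset W} (sel : Fin d → Fin c ⊕ T) (g : Fin c → W) :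
    Finset W :=
  univ.image fun r => Sum.elim g (fun w : T => (w : W)) (sel r)

/-- This lets the union bound run over the selections `sel`, whose number is independent of `n`,
instead of over the `d`-subsets of the vertex set. -/
theorem exists_selected_eq {c d : ℕ} {T D : Finset W} (g : Fin c → W)
    (hD : D ⊆ univ.image g ∪ T) (hd : #D = d) : ∃ sel : Fin d → Fin c ⊕ T, selected sel g = D := by
  let e := (Finset.equivFinOfCardEq hd).symm
  have h : ∀ r, ∃ z : Fin c ⊕ T, Sum.elim g (fun w : T => (w : W)) z = e r := by
    intro r
    rcases Finset.mem_union.1 (hD (e r).2) with h | h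
    · obtain ⟨i, -, hi⟩ := Finset.mem_image.1 h
      exact ⟨Sum.inl i, hi⟩
    · exact ⟨Sum.inr ⟨_, h⟩, rfl⟩
  choose sel hsel using h
  refine ⟨sel, ?_⟩
  ext w
  simp only [selected, Finset.mem_image, Finset.mem_univ, true_and, hsel]
  refine ⟨?_, fun hw => ⟨e.symm ⟨w, hw⟩, by simp⟩⟩
  rintro ⟨r, rfl⟩
  exact (e r).2

theorem selected_congr {c d : ℕ} {T : Finset W} (sel : Fin d → Fin c ⊕ T) {g g' : Fin c → W}
    (h : ∀ i, (∃ r, sel r = Sum.inl i) → g i = g' i) : selected sel g = selected sel g' := by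
  unfold selected
  refine Finset.image_congr fun r _ => ?_
  rcases hr : sel r with i | w
  · exact h i ⟨r, hr⟩
  · rfl

/-- The coordinates of the sample that are not selected by `sel`. -/
abbrev Free {c d : ℕ} {T : Finset W} (sel : Fin d → Fin c ⊕ T) : Type :=
  {i : Fin c // ¬ ∃ r, sel r = Sum.inl i}

variable [Fintype W]

/-- Few samples are sparse around the `d`-set selected by `sel`. -/
theorem card_sparse_around_selected_le {c d l B : ℕ} {T : Finset W} (E : Finset W → Prop)
    (sel : Fin d → Fin c ⊕ T) (hB : B * l ≤ c - d) (hl : l ≤ c - d) (q a lam : ℝ) (hlam : 0 ≤ lam)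
    (hq : ∀ D : Finset W, #D = d →
      q * (Fintype.card W : ℝ) ^ l ≤ #{x : Fin l → W | E (D ∪ univ.image x)}) :
    (#{g : Fin c → W | #(selected sel g) = d ∧
      (#{Z ∈ powersetCard l (univ : Finset (Free sel)) |
        E (selected sel g ∪ Z.image fun i : Free sel => g i)} : ℝ) ≤
        a * (Fintype.card (Free sel)).choose l} : ℝ) ≤
      (Fintype.card W : ℝ) ^ c * Real.exp (B * (lam * a - q * (1 - Real.exp (-lam)))) := by
  set ι := Free sel with hι
  set b := Fintype.card ι with hb
  set n := Fintype.card W with hn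
  have hcompl : Fintype.card {i : Fin c // ∃ r, sel r = Sum.inl i} + b = c := by
    have h1 := Fintype.card_subtype_compl fun i : Fin c => ∃ r, sel r = Sum.inl i
    have h2 := Fintype.card_subtype_le fun i : Fin c => ∃ r, sel r = Sum.inl i
    rw [Fintype.card_fin] at h1 h2
    have h3 : b = Fintype.card {i : Fin c // ¬ ∃ r, sel r = Sum.inl i} := Fintype.card_congr
      (Equiv.refl _)
    omega
  have hd : Fintype.card {i : Fin c // ∃ r, sel r = Sum.inl i} ≤ d := by
    have h := Fintype.card_le_of_injective
      (fun i : {i : Fin c // ∃ r, sel r = Sum.inl i} => i.2.choose) fun i j hij => by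
        have hi := i.2.choose_spec
        have hj := j.2.choose_spec
        have hij' : i.2.choose = j.2.choose := hij
        rw [hij', hj] at hi
        exact Subtype.ext (Sum.inl.inj hi).symm
    simpa using h
  set ev : Finset (Fin c → W) := {g : Fin c → W | #(selected sel g) = d ∧
      (#{Z ∈ powersetCard l (univ : Finset ι) |
        E (selected sel g ∪ Z.image fun i : Free sel => g i)} : ℝ) ≤ a * b.choose l} with hev
  let res : (Fin c → W) → {i : Fin c // ∃ r, sel r = Sum.inl i} → W := fun g i => g i
  -- Once the selected coordinates are fixed, so is the `d`-set, and the free coordinates form an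
  -- independent sample to which the concentration bound applies.
  have hfib : ∀ h, (#{g ∈ ev | res g = h} : ℝ) ≤
      (n : ℝ) ^ b * Real.exp (B * (lam * a - q * (1 - Real.exp (-lam)))) := by
    intro h
    rcases Finset.eq_empty_or_nonempty {g ∈ ev | res g = h} with h0 | ⟨g₀, hg₀⟩
    · rw [h0]
      simp only [Finset.card_empty, Nat.cast_zero]
      positivity
    rw [Finset.mem_filter, hev, Finset.mem_filter] at hg₀
    have key := card_sparse_samples_le (ι := ι) (W := W) (l := l) (B := B) (by omega) (by omega)
      (fun X => E (selected sel g₀ ∪ X)) q a lam hlam (hq _ hg₀.1.2.1)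
    refine le_trans ?_ key
    have hle : #{g ∈ ev | res g = h} ≤
        #{g : ι → W | (#{Z ∈ powersetCard l (univ : Finset ι) |
          E (selected sel g₀ ∪ Z.image g)} : ℝ) ≤ a * b.choose l} := by
      refine Finset.card_le_card_of_injOn (fun g i => g i) (fun g hg => ?_)
        fun g hg g' hg' hgg => ?_
      · simp only [Finset.coe_filter, hev, Set.mem_ofPred_eq, Finset.mem_filter, Finset.mem_univ,
          true_and] at hg ⊢
        have hs : selected sel g = selected sel g₀ := selected_congr sel fun i hi =>
          congrFun (hg.2.trans hg₀.2.symm) ⟨i, hi⟩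
        rw [← hs]
        exact hg.1.2
      · simp only [Finset.coe_filter, Set.mem_ofPred_eq] at hg hg'
        funext i
        by_cases hi : ∃ r, sel r = Sum.inl i
        · exact congrFun (hg.2.trans hg'.2.symm) ⟨i, hi⟩
        · exact congrFun hgg ⟨i, hi⟩
    refine (Nat.cast_le.2 hle).trans (le_of_eq ?_)
    congr!
  have hsum : (#ev : ℝ) = ∑ h : {i : Fin c // ∃ r, sel r = Sum.inl i} → W,
      (#{g ∈ ev | res g = h} : ℝ) := by
    exact_mod_cast Finset.card_eq_sum_card_fiberwise (f := res) (t := univ) fun _ _ => by simp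
  rw [hsum]
  refine (Finset.sum_le_card_nsmul _ _ _ fun h _ => hfib h).trans_eq ?_
  rw [Finset.card_univ, Fintype.card_fun, nsmul_eq_mul, ← hn, ← mul_assoc]
  push_cast
  rw [← pow_add, hcompl]

/-- Few samples fail to be rich with respect to a fixed small set `T`. -/
theorem card_not_rich_le {c d l t B : ℕ} {T : Finset W} (E : Finset W → Prop) (hT : #T ≤ t + 1)
    (hB : B * l ≤ c - d) (hl : l ≤ c - d) (θ q a lam : ℝ) (hlam : 0 ≤ lam) (ha : 0 ≤ a)
    (hθ : θ * ((c + t + 1).choose l : ℝ) ≤ a * (c - d).choose l)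
    (hq : ∀ D : Finset W, #D = d →
      q * (Fintype.card W : ℝ) ^ l ≤ #{x : Fin l → W | E (D ∪ univ.image x)}) :
    (#{g : Fin c → W | Function.Injective g ∧ ¬ Rich E d l t θ T (univ.image g)} : ℝ) ≤
      ((c : ℝ) + t + 1) ^ d * ((Fintype.card W : ℝ) ^ c *
        Real.exp (B * (lam * a - q * (1 - Real.exp (-lam))))) := by
  let ev : (Fin d → Fin c ⊕ T) → Finset (Fin c → W) := fun sel =>
    {g : Fin c → W | #(selected sel g) = d ∧
      (#{Z ∈ powersetCard l (univ : Finset (Free sel)) |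
        E (selected sel g ∪ Z.image fun i : Free sel => g i)} : ℝ) ≤
        a * (Fintype.card (Free sel)).choose l}
  have hsub : ({g : Fin c → W | Function.Injective g ∧ ¬ Rich E d l t θ T (univ.image g)} :
      Finset (Fin c → W)) ⊆ univ.biUnion ev := by
    intro g hg
    simp only [Finset.mem_filter, Finset.mem_univ, true_and] at hg
    obtain ⟨hinj, hg⟩ := hg
    unfold Rich at hg
    push Not at hg
    obtain ⟨D, hD, hDd, hlt⟩ := hg
    obtain ⟨sel, rfl⟩ := exists_selected_eq g hD hDd
    rw [Finset.card_image_of_injective _ hinj, Finset.card_univ, Fintype.card_fin] at hlt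
    simp only [Finset.mem_biUnion, Finset.mem_univ, true_and, ev, Finset.mem_filter]
    refine ⟨sel, hDd, ?_⟩
    set ι := Free sel with hι
    have hb : c - d ≤ Fintype.card ι := by
      have h1 := Fintype.card_subtype_compl fun i : Fin c => ∃ r, sel r = Sum.inl i
      have h := Fintype.card_le_of_injective
        (fun i : {i : Fin c // ∃ r, sel r = Sum.inl i} => i.2.choose) fun i j hij => by
          have hi := i.2.choose_spec
          have hj := j.2.choose_spec
          have hij' : i.2.choose = j.2.choose := hij
          rw [hij', hj] at hi
          exact Subtype.ext (Sum.inl.inj hi).symm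
      rw [Fintype.card_fin] at h1 h
      have h3 : Fintype.card ι = Fintype.card {i : Fin c // ¬ ∃ r, sel r = Sum.inl i} :=
        Fintype.card_congr (Equiv.refl _)
      omega
    have hle : #{Z ∈ powersetCard l (univ : Finset ι) |
        E (selected sel g ∪ Z.image fun i : Free sel => g i)} ≤ degIn E l (selected sel g) (univ.image g) := by
      have hinj' : Function.Injective fun i : ι => g i := hinj.comp Subtype.val_injective
      refine Finset.card_le_card_of_injOn (fun Z => Z.image fun i : ι => g i) (fun Z hZ => ?_)
        (Finset.image_injective hinj').injOn
      simp only [Finset.coe_filter, Set.mem_ofPred_eq, Finset.mem_powersetCard] at hZ ⊢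
      refine ⟨⟨?_, ?_⟩, hZ.2⟩
      · intro w hw
        obtain ⟨i, -, rfl⟩ := Finset.mem_image.1 hw
        exact Finset.mem_image_of_mem g (Finset.mem_univ _)
      · rw [Finset.card_image_of_injective _ hinj', hZ.1.2]
    calc (_ : ℝ) ≤ degIn E l (selected sel g) (univ.image g) := by exact_mod_cast hle
      _ ≤ θ * ((c + t + 1).choose l : ℝ) := hlt.le
      _ ≤ a * (c - d).choose l := hθ
      _ ≤ _ := by
        have : (c - d).choose l ≤ (Fintype.card ι).choose l := Nat.choose_le_choose l hb
        have : ((c - d).choose l : ℝ) ≤ (Fintype.card ι).choose l := by exact_mod_cast this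
        gcongr
  have hev : ∀ sel, (#(ev sel) : ℝ) ≤ (Fintype.card W : ℝ) ^ c *
        Real.exp (B * (lam * a - q * (1 - Real.exp (-lam)))) := fun sel =>
    card_sparse_around_selected_le E sel hB hl q a lam hlam hq
  calc _ ≤ ((#(univ.biUnion ev) : ℕ) : ℝ) := by exact_mod_cast Finset.card_le_card hsub
    _ ≤ ∑ sel, (#(ev sel) : ℝ) := by exact_mod_cast Finset.card_biUnion_le
    _ ≤ Fintype.card (Fin d → Fin c ⊕ T) • ((Fintype.card W : ℝ) ^ c *
        Real.exp (B * (lam * a - q * (1 - Real.exp (-lam))))) :=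
      Finset.sum_le_card_nsmul _ _ _ fun sel _ => hev sel
    _ ≤ _ := by
      rw [nsmul_eq_mul, Fintype.card_fun, Fintype.card_sum, Fintype.card_fin, Fintype.card_fin,
        Fintype.card_coe]
      push_cast
      have : (#T : ℝ) ≤ t + 1 := by exact_mod_cast hT
      gcongr ?_ ^ d * _
      linarith

end

/-! ### Numerical estimates -/

/-- Each of the `l` factors of the falling factorial is at least `(n + s)(1 - (d + l + s)/(n + s))`;
Bernoulli's inequality then bounds the total relative loss by `η`. -/
theorem le_choose_mul_factorial (n d l s : ℕ) (η : ℝ)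
    (hn : (l : ℝ) * (d + l + s) ≤ η * (n + s)) (hdl : d + l ≤ n) (hn0 : 0 < n) :
    (1 - η) * ((n : ℝ) + s) ^ l ≤ ((n - d).choose l : ℝ) * (l ! : ℝ) := by
  have hns : (0 : ℝ) < n + s := by positivity
  have h1 : ((n - d - l : ℕ) : ℝ) ^ l ≤ ((n - d).choose l : ℝ) * (l ! : ℝ) := by
    have h2 := Nat.pow_sub_le_descFactorial (n - d) l
    rw [Nat.descFactorial_eq_factorial_mul_choose, mul_comm] at h2
    exact_mod_cast (Nat.pow_le_pow_left (by omega) _).trans h2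
  refine le_trans ?_ h1
  have h3 : ((n - d - l : ℕ) : ℝ) = (n + s) * (1 + -((d + l + s : ℝ) / (n + s))) := by
    rw [Nat.cast_sub (by omega), Nat.cast_sub (by omega)]
    field_simp
    ring
  have h4 := one_add_mul_le_pow (a := -((d + l + s : ℝ) / (n + s))) (by
    have : (d + l + s : ℝ) / (n + s) ≤ 1 := by
      rw [div_le_one hns]
      have : (d + l : ℝ) ≤ n := by exact_mod_cast hdl
      linarith
    linarith) l
  rw [h3, mul_pow, mul_comm (1 - η)]
  gcongr
  refine le_trans ?_ h4
  have : (l : ℝ) * ((d + l + s : ℝ) / (n + s)) ≤ η := by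
    rw [← mul_div_assoc, div_le_iff₀ hns]
    exact hn
  linarith

/-- Two effects of a large sample: replacing `c - d` by `c + t + 1` in the binomial costs less than
the margin `α/8`, and the exponential decay beats the `(c + t + 1)^d` selections together with the
desired `c^p`. -/
theorem exists_sample_size (d l t p : ℕ) (hl : 1 ≤ l) (α : ℝ) (hα : 0 < α) :
    ∃ c₀ : ℕ, ∀ c : ℕ, c₀ ≤ c → d + l ≤ c ∧
      (∀ θ : ℝ, 0 ≤ θ → θ ≤ 3 / 2 → α ≤ 1 →
        θ * ((c + t + 1).choose l : ℝ) ≤ (θ + α / 8) * (c - d).choose l) ∧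
      (c : ℝ) ^ p * (((c : ℝ) + t + 1) ^ d *
        Real.exp (((c - d) / l : ℕ) * (-(α ^ 2 / 512)))) ≤ 1 := by
  have h1 : ∀ᶠ c : ℕ in Filter.atTop,
      (l : ℝ) * (d + l + (t + 1 : ℕ)) ≤ α / 16 * (c + (t + 1 : ℕ)) := by
    have h : Filter.Tendsto (fun c : ℕ => α / 16 * ((c : ℝ) + (t + 1 : ℕ))) Filter.atTop
        Filter.atTop :=
      (Filter.tendsto_atTop_add_const_right _ _ tendsto_natCast_atTop_atTop).const_mul_atTop
        (by positivity)
    exact h.eventually_ge_atTop _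
  set κ : ℝ := α ^ 2 / 512 / l with hκ
  have hlR : (0 : ℝ) < l := by exact_mod_cast hl
  have hκ0 : 0 < κ := by positivity
  have h2 : ∀ᶠ c : ℕ in Filter.atTop,
      (κ * ((c : ℝ) + (t + 1))) ^ (p + d) * Real.exp (-(κ * ((c : ℝ) + (t + 1)))) ≤
        κ ^ (p + d) * Real.exp (-(κ * (d + l + (t + 1)))) := by
    have h : Filter.Tendsto (fun c : ℕ => κ * ((c : ℝ) + (t + 1))) Filter.atTop Filter.atTop :=
      (Filter.tendsto_atTop_add_const_right _ _ tendsto_natCast_atTop_atTop).const_mul_atTop hκ0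
    have h' := (Real.tendsto_pow_mul_exp_neg_atTop_nhds_zero (p + d)).comp h
    exact (h'.eventually_lt_const (u := κ ^ (p + d) * Real.exp (-(κ * (d + l + (t + 1)))))
      (by positivity)).mono fun c hc => hc.le
  obtain ⟨c₀, hc₀⟩ := Filter.eventually_atTop.1 (h1.and h2)
  refine ⟨c₀ + d + l, fun c hc => ⟨by omega, ?_, ?_⟩⟩
  · intro θ hθ0 hθ hα1
    have h3 := le_choose_mul_factorial c d l (t + 1) (α / 16) (hc₀ c (by omega)).1 (by omega)
      (by omega)
    have h4 : ((c + t + 1).choose l : ℝ) * (l ! : ℝ) ≤ ((c : ℝ) + (t + 1 : ℕ)) ^ l := by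
      have := Nat.choose_le_pow_div (α := ℝ) l (c + t + 1)
      rw [le_div_iff₀ (by positivity)] at this
      refine this.trans_eq ?_
      push_cast
      ring
    have h5 : (0 : ℝ) < (l ! : ℝ) := by positivity
    refine le_of_mul_le_mul_right ?_ h5
    calc θ * ((c + t + 1).choose l : ℝ) * (l ! : ℝ)
        ≤ θ * ((c : ℝ) + (t + 1 : ℕ)) ^ l := by rw [mul_assoc]; gcongr
      _ ≤ ((θ + α / 8) * (1 - α / 16)) * ((c : ℝ) + (t + 1 : ℕ)) ^ l := by
          gcongr
          nlinarith
      _ = (θ + α / 8) * ((1 - α / 16) * ((c : ℝ) + (t + 1 : ℕ)) ^ l) := by ring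
      _ ≤ (θ + α / 8) * ((c - d).choose l * (l ! : ℝ)) := by gcongr
      _ = _ := by ring
  · have h3 := (hc₀ c (by omega)).2
    rw [mul_pow, mul_assoc] at h3
    have h4 : ((c : ℝ) + (t + 1)) ^ (p + d) * Real.exp (-(κ * ((c : ℝ) + (t + 1)))) ≤
        Real.exp (-(κ * (d + l + (t + 1)))) := le_of_mul_le_mul_left h3 (by positivity)
    have h5 : ((c : ℝ) - d - l) / l ≤ ((c - d) / l : ℕ) := by
      have h6 : c - d < l * ((c - d) / l + 1) := by
        have := Nat.div_add_mod (c - d) l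
        have := Nat.mod_lt (c - d) hl
        rw [Nat.mul_add, mul_one]
        omega
      have h7 : ((c - d : ℕ) : ℝ) < l * (((c - d) / l : ℕ) + 1) := by exact_mod_cast h6
      rw [Nat.cast_sub (by omega)] at h7
      rw [div_le_iff₀ hlR]
      linarith
    calc (c : ℝ) ^ p * (((c : ℝ) + t + 1) ^ d *
        Real.exp (((c - d) / l : ℕ) * (-(α ^ 2 / 512))))
        ≤ ((c : ℝ) + (t + 1)) ^ p * (((c : ℝ) + (t + 1)) ^ d *
          Real.exp (-(κ * (c + (t + 1))) + κ * (d + l + (t + 1)))) := by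
          rw [add_assoc]
          have : ((((c - d) / l : ℕ) : ℝ) * (-(α ^ 2 / 512))) ≤
              -(κ * (c + (t + 1))) + κ * (d + l + (t + 1)) := by
            have h8 : κ * ((c : ℝ) - d - l) ≤ α ^ 2 / 512 * ((c - d) / l : ℕ) := by
              calc κ * ((c : ℝ) - d - l) = α ^ 2 / 512 * (((c : ℝ) - d - l) / l) := by
                    rw [hκ]; ring
                _ ≤ _ := by gcongr
            linarith
          gcongr
          have : (0 : ℝ) ≤ t := by positivity
          linarith
      _ = (((c : ℝ) + (t + 1)) ^ (p + d) * Real.exp (-(κ * ((c : ℝ) + (t + 1))))) *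
          Real.exp (κ * (d + l + (t + 1))) := by
          rw [Real.exp_add, pow_add]; ring
      _ ≤ Real.exp (-(κ * (d + l + (t + 1)))) * Real.exp (κ * (d + l + (t + 1))) := by gcongr
      _ = 1 := by rw [← Real.exp_add]; simp

/-- For a hypergraph of large minimum degree, a random sample of size `c` is rich with respect to
any fixed small set except with probability `c ^ (-p)`. -/
theorem exists_card_not_rich_le (d l t p : ℕ) (hl : 1 ≤ l) (α : ℝ) (hα : 0 < α) (hα1 : α ≤ 1) :
    ∃ c₀ : ℕ, ∀ c : ℕ, c₀ ≤ c → ∀ δ : ℝ, 0 ≤ δ → δ ≤ 1 →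
      ∀ (W : Type) [Fintype W] (E : Finset W → Prop),
      (∀ D : Finset W, #D = d → (δ + 3 / 4 * α) * (Fintype.card W : ℝ) ^ l ≤
        #{x : Fin l → W | E (D ∪ univ.image x)}) →
      ∀ T : Finset W, #T ≤ t + 1 →
      (c : ℝ) ^ p * (#{g : Fin c → W | Function.Injective g ∧
        ¬ Rich E d l t (δ + α / 2) T (univ.image g)} : ℝ) ≤ (Fintype.card W : ℝ) ^ c := by
  obtain ⟨c₀, hc₀⟩ := exists_sample_size d l t p hl α hα
  refine ⟨c₀, fun c hc δ hδ hδ1 W _ E hE T hT => ?_⟩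
  obtain ⟨hdl, hch, hexp⟩ := hc₀ c hc
  have h1 := card_not_rich_le (B := (c - d) / l) E hT (Nat.div_mul_le_self _ _) (by omega)
    (δ + α / 2) (δ + 3 / 4 * α) (δ + α / 2 + α / 8) (α / 32) (by positivity) (by positivity)
    (hch _ (by positivity) (by linarith) hα1) hE
  -- With `lam = α/32`, the gap `α/8` between the two densities gains `α²/256`, while the quadratic
  -- error of the exponential loses at most `2 lam² = α²/512`.
  have h2 : α / 32 * (δ + α / 2 + α / 8) - (δ + 3 / 4 * α) * (1 - Real.exp (-(α / 32))) ≤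
      -(α ^ 2 / 512) := by
    have h3 := Real.abs_exp_sub_one_sub_id_le (x := -(α / 32)) (by
      rw [abs_neg, abs_of_pos (by positivity)]; linarith)
    have h4 : Real.exp (-(α / 32)) ≤ 1 - α / 32 + (α / 32) ^ 2 := by
      have := (abs_le.1 h3).2
      nlinarith
    have h5 : α / 32 - (α / 32) ^ 2 ≤ 1 - Real.exp (-(α / 32)) := by linarith
    have h6 : (δ + 3 / 4 * α) * (α / 32 - (α / 32) ^ 2) ≤
        (δ + 3 / 4 * α) * (1 - Real.exp (-(α / 32))) := by gcongr
    have h7 : (δ + 3 / 4 * α) * (α / 32) ^ 2 ≤ 2 * (α / 32) ^ 2 := by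
      gcongr
      linarith
    nlinarith
  calc _ ≤ (c : ℝ) ^ p * (((c : ℝ) + t + 1) ^ d * ((Fintype.card W : ℝ) ^ c *
        Real.exp (((c - d) / l : ℕ) * (-(α ^ 2 / 512))))) := by
        refine mul_le_mul_of_nonneg_left (h1.trans ?_) (by positivity)
        gcongr
    _ = ((c : ℝ) ^ p * (((c : ℝ) + t + 1) ^ d *
        Real.exp (((c - d) / l : ℕ) * (-(α ^ 2 / 512))))) * (Fintype.card W : ℝ) ^ c := by ring
    _ ≤ 1 * (Fintype.card W : ℝ) ^ c := by gcongr
    _ = _ := one_mul _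

/-! ### Random blocks -/

/-- Positions of a random ordering: an exceptional block with a distinguished position, and `M`
blocks of size `c`. -/
abbrev Pos (b M c : ℕ) : Type := Option (Fin b) ⊕ (Fin M × Fin c)

section

variable {W : Type} {b M c : ℕ}

/-- The `j`-th block of `σ`. -/
noncomputable def block (σ : Pos b M c ≃ W) (j : Fin M) : Finset W :=
  univ.image fun a => σ (Sum.inr (j, a))

/-- The exceptional block without its distinguished vertex. -/
noncomputable def base (σ : Pos b M c ≃ W) : Finset W :=
  univ.image fun a => σ (Sum.inl (some a))

/-- The distinguished vertex of the exceptional block. -/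
def apex (σ : Pos b M c ≃ W) : W := σ (Sum.inl none)

/-- The first `t` vertices of the `j`-th block. -/
noncomputable def part (t : ℕ) (σ : Pos b M c ≃ W) (j : Fin M) : Finset W :=
  (univ.filter fun a : Fin c => (a : ℕ) < t).image fun a => σ (Sum.inr (j, a))

theorem card_block (σ : Pos b M c ≃ W) (j : Fin M) : #(block σ j) = c := by
  rw [block, Finset.card_image_of_injective]
  · simp
  · intro a a' h
    simpa using h

theorem card_base (σ : Pos b M c ≃ W) : #(base σ) = b := by
  rw [base, Finset.card_image_of_injective]
  · simp
  · intro a a' h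
    simpa using h

theorem part_subset_block (t : ℕ) (σ : Pos b M c ≃ W) (j : Fin M) : part t σ j ⊆ block σ j :=
  Finset.image_subset_image (Finset.filter_subset _ _)

theorem card_part {t : ℕ} (ht : t ≤ c) (σ : Pos b M c ≃ W) (j : Fin M) : #(part t σ j) = t := by
  rw [part, Finset.card_image_of_injective]
  · have := Fin.card_filter_val_lt (n := c) (m := t)
    simpa [ht] using this
  · intro a a' h
    simpa using h

variable [Fintype W]

theorem card_forall_block_mem_le (A : Finset (Fin c → W)) (J : Finset (Fin M))
    (hn : Fintype.card W = b + 1 + M * c) :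
    #{σ : Pos b M c ≃ W | ∀ j ∈ J, (fun a => σ (Sum.inr (j, a))) ∈ A} ≤
      #A ^ #J * (Fintype.card W - #J * c)! := by
  let ι : J × Fin c ↪ Pos b M c :=
    ⟨fun x => Sum.inr (x.1, x.2), fun x y h => by
      simp only [Sum.inr.injEq, Prod.mk.injEq] at h
      exact Prod.ext (Subtype.ext h.1) h.2⟩
  have h1 := card_equiv_restrict_mem_le (W := W) ι
    {h : J × Fin c → W | ∀ j, (fun a => h (j, a)) ∈ A}
  have h2 : #{h : J × Fin c → W | ∀ j, (fun a => h (j, a)) ∈ A} ≤ #A ^ #J := by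
    have h3 : #(Fintype.piFinset fun _ : J => A) = #A ^ #J := by
      rw [Fintype.card_piFinset]
      simp
    rw [← h3]
    refine Finset.card_le_card_of_injOn (fun h j a => h (j, a)) (fun h hh => ?_)
      fun h _ h' _ hh => ?_
    · simpa using hh
    · funext x
      exact congrFun (congrFun hh x.1) x.2
  have hP : Fintype.card (Pos b M c) = Fintype.card W := by
    simp [hn]
  rw [hP, Fintype.card_prod, Fintype.card_coe, Fintype.card_fin] at h1
  refine le_trans (Finset.card_le_card fun σ hσ => ?_) (h1.trans (Nat.mul_le_mul_right _ h2))
  simp only [Finset.mem_filter, Finset.mem_univ, true_and] at hσ ⊢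
  exact fun j => hσ j j.2

/-- The number of orderings with at least `x` blocks from a sparse set `A`. -/
theorem card_many_blocks_mem_le (A : Finset (Fin c → W)) (x : ℕ) (hc : 4 ≤ c) (hx : 0 < x)
    (hn : Fintype.card W = b + 1 + M * c)
    (hA : (c : ℝ) ^ 6 * #A ≤ (Fintype.card W : ℝ) ^ c)
    (hxn : 2 * x * c ^ 2 ≤ Fintype.card W) (hM : M ≤ x * c ^ 4) :
    (2 : ℝ) ^ x * #{σ : Pos b M c ≃ W |
      x ≤ #{j : Fin M | (fun a => σ (Sum.inr (j, a))) ∈ A}} ≤ ((Fintype.card W)! : ℝ) := by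
  set n := Fintype.card W with hn'
  have hcR : (4 : ℝ) ≤ c := by exact_mod_cast hc
  have hsub : ({σ : Pos b M c ≃ W | x ≤ #{j : Fin M | (fun a => σ (Sum.inr (j, a))) ∈ A}} :
      Finset (Pos b M c ≃ W)) ⊆ (powersetCard x (univ : Finset (Fin M))).biUnion fun J =>
        {σ : Pos b M c ≃ W | ∀ j ∈ J, (fun a => σ (Sum.inr (j, a))) ∈ A} := by
    intro σ hσ
    rw [Finset.mem_filter] at hσ
    obtain ⟨J, hJ, hJx⟩ := Finset.exists_subset_card_eq hσ.2
    simp only [Finset.mem_biUnion, Finset.mem_powersetCard, Finset.mem_filter, Finset.mem_univ,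
      true_and]
    exact ⟨J, ⟨Finset.subset_univ _, hJx⟩, fun j hj => (Finset.mem_filter.1 (hJ hj)).2⟩
  have h1 : (#{σ : Pos b M c ≃ W | x ≤ #{j : Fin M | (fun a => σ (Sum.inr (j, a))) ∈ A}} : ℝ) ≤
      M.choose x * ((#A : ℝ) ^ x * ((n - x * c)! : ℝ)) := by
    have h2 : #{σ : Pos b M c ≃ W | x ≤ #{j : Fin M | (fun a => σ (Sum.inr (j, a))) ∈ A}} ≤
        M.choose x * (#A ^ x * (n - x * c)!) := by
      refine (Finset.card_le_card hsub).trans (Finset.card_biUnion_le.trans ?_)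
      refine (Finset.sum_le_card_nsmul _ _ (#A ^ x * (n - x * c)!) fun J hJ => ?_).trans_eq ?_
      · have h3 := card_forall_block_mem_le A J hn
        rwa [(Finset.mem_powersetCard.1 hJ).2] at h3
      · rw [Finset.card_powersetCard, Finset.card_univ, Fintype.card_fin, smul_eq_mul]
    exact_mod_cast h2
  have h2 := pow_mul_factorial_sub_mul_le n x c hxn
  have h3 := choose_mul_pow_le M x
  have h4 : ((c : ℝ) ^ 6) ^ x * (#A : ℝ) ^ x ≤ (n : ℝ) ^ (x * c) := by
    rw [← mul_pow, mul_comm x c, pow_mul]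
    gcongr
  have hxR : (0 : ℝ) < x := by exact_mod_cast hx
  -- Since `x` is at least `M / c^4`, choosing the failing blocks costs at most `3c^4` per block.
  -- Against the gain `c^6` this leaves `c²`, enough to absorb `12 = 3 · 2 · 2`.
  have h5 : (M.choose x : ℝ) ≤ (3 * (c : ℝ) ^ 4) ^ x := by
    refine le_of_mul_le_mul_right (h3.trans ?_) (pow_pos hxR x)
    rw [← mul_pow]
    refine pow_le_pow_left₀ (by positivity) ?_ x
    have h6 : (M : ℝ) ≤ x * c ^ 4 := by exact_mod_cast hM
    have h7 : Real.exp 1 ≤ 3 := by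
      have := Real.exp_one_lt_d9
      linarith
    calc Real.exp 1 * (M : ℝ) ≤ 3 * (x * c ^ 4) := by gcongr
      _ = _ := by ring
  have hpos : (0 : ℝ) < ((c : ℝ) ^ 6) ^ x := by positivity
  refine le_of_mul_le_mul_left ?_ hpos
  calc ((c : ℝ) ^ 6) ^ x * (2 ^ x * (#{σ : Pos b M c ≃ W |
        x ≤ #{j : Fin M | (fun a => σ (Sum.inr (j, a))) ∈ A}} : ℝ))
      ≤ ((c : ℝ) ^ 6) ^ x * (2 ^ x * ((3 * (c : ℝ) ^ 4) ^ x *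
        ((#A : ℝ) ^ x * ((n - x * c)! : ℝ)))) := by
        gcongr
        exact h1.trans (by gcongr)
    _ = 2 ^ x * (3 * (c : ℝ) ^ 4) ^ x *
        ((((c : ℝ) ^ 6) ^ x * (#A : ℝ) ^ x) * ((n - x * c)! : ℝ)) := by ring
    _ ≤ 2 ^ x * (3 * (c : ℝ) ^ 4) ^ x * ((n : ℝ) ^ (x * c) * ((n - x * c)! : ℝ)) := by gcongr
    _ ≤ 2 ^ x * (3 * (c : ℝ) ^ 4) ^ x * (2 ^ x * (n ! : ℝ)) := by gcongr
    _ = (12 * (c : ℝ) ^ 4) ^ x * (n ! : ℝ) := by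
        rw [show (12 : ℝ) * (c : ℝ) ^ 4 = 2 * (3 * (c : ℝ) ^ 4) * 2 by ring,
          mul_pow (2 * (3 * (c : ℝ) ^ 4)), mul_pow (2 : ℝ) (3 * (c : ℝ) ^ 4)]
        ring
    _ ≤ _ := by
        gcongr
        calc (12 : ℝ) * (c : ℝ) ^ 4 ≤ c ^ 2 * c ^ 4 := by gcongr; nlinarith
          _ = _ := by ring

-- Here the forbidden set `A` depends on other vertices of the same ordering: the apex and the start
-- of block `j`. Only `b + (t + 1)` positions are involved, so conditioning on the last `t + 1` of
-- them costs at most a factor `2` compared with independent sampling.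
set_option maxHeartbeats 800000 in
theorem card_base_mem_le {t : ℕ} (ht : t ≤ c) (j : Fin M)
    (hn : Fintype.card W = b + 1 + M * c) (A : (Fin (t + 1) → W) → Finset (Fin b → W))
    (w : ℝ) (hA : ∀ τ, (#(A τ) : ℝ) ≤ w)
    (hbn : 2 * (b + (t + 1)) ^ 2 ≤ Fintype.card W) :
    (Fintype.card W : ℝ) ^ b * #{σ : Pos b M c ≃ W | (fun a => σ (Sum.inl (some a))) ∈
      A (Fin.cons (σ (Sum.inl none)) fun a => σ (Sum.inr (j, Fin.castLE ht a)))} ≤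
        2 * w * ((Fintype.card W)! : ℝ) := by
  set n := Fintype.card W with hn'
  let ι : Fin b ⊕ Fin (t + 1) ↪ Pos b M c :=
    ⟨Sum.elim (fun a => Sum.inl (some a))
      (Fin.cons (Sum.inl none) fun a => Sum.inr (j, Fin.castLE ht a)), by
      rintro (a | a) (a' | a') h
      · simpa using h
      · refine Fin.cases ?_ (fun a' => ?_) a' h <;> simp
      · refine Fin.cases ?_ (fun a => ?_) a h <;> simp
      · simp only [Sum.elim_inr] at h
        congr 1
        revert h
        refine Fin.cases ?_ (fun a => ?_) a <;> refine Fin.cases ?_ (fun a' => ?_) a' <;> simp⟩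
  let G : Finset (Fin b ⊕ Fin (t + 1) → W) :=
    {h | (fun a => h (Sum.inl a)) ∈ A fun a => h (Sum.inr a)}
  have hG : (#G : ℝ) ≤ (n : ℝ) ^ (t + 1) * w := by
    have h1 : (#G : ℝ) = ∑ τ : Fin (t + 1) → W, (#{h ∈ G | (fun a => h (Sum.inr a)) = τ} : ℝ) := by
      exact_mod_cast Finset.card_eq_sum_card_fiberwise
        (f := fun (h : Fin b ⊕ Fin (t + 1) → W) a => h (Sum.inr a)) (t := univ) fun _ _ => by simp
    rw [h1]
    refine (Finset.sum_le_card_nsmul _ _ w fun τ _ => ?_).trans_eq ?_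
    · refine le_trans ?_ (hA τ)
      have h2 : #{h ∈ G | (fun a => h (Sum.inr a)) = τ} ≤ #(A τ) := by
        refine Finset.card_le_card_of_injOn (fun h a => h (Sum.inl a)) (fun h hh => ?_)
          fun h hh h' hh' hhh => ?_
        · simp only [Finset.coe_filter, Set.mem_ofPred_eq, G, Finset.mem_filter, Finset.mem_univ,
            true_and] at hh
          rw [← hh.2]
          exact hh.1
        · simp only [Finset.coe_filter, Set.mem_ofPred_eq] at hh hh'
          funext x
          rcases x with a | a
          · exact congrFun hhh a
          · exact congrFun (hh.2.trans hh'.2.symm) a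
      exact_mod_cast h2
    · rw [Finset.card_univ, Fintype.card_fun, Fintype.card_fin, nsmul_eq_mul]
      push_cast
      rfl
  have h1 := card_equiv_restrict_mem_le (W := W) ι G
  have hP : Fintype.card (Pos b M c) = n := by simp [hn]
  rw [hP, Fintype.card_sum, Fintype.card_fin, Fintype.card_fin] at h1
  have h2 : #{σ : Pos b M c ≃ W | (fun a => σ (Sum.inl (some a))) ∈
      A (Fin.cons (σ (Sum.inl none)) fun a => σ (Sum.inr (j, Fin.castLE ht a)))} ≤
      #{σ : Pos b M c ≃ W | (fun x => σ (ι x)) ∈ G} := by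
    refine Finset.card_le_card fun σ hσ => ?_
    simp only [Finset.mem_filter, Finset.mem_univ, true_and, G] at hσ ⊢
    have h4 : (fun a => σ (ι (Sum.inr a))) =
        (Fin.cons (σ (Sum.inl none)) fun a => σ (Sum.inr (j, Fin.castLE ht a))) := by
      funext a
      exact Fin.cases rfl (fun _ => rfl) a
    rw [h4]
    exact hσ
  have h3 := pow_mul_factorial_sub_mul_le n 1 (b + (t + 1)) (by rw [mul_one]; exact hbn)
  simp only [one_mul, pow_one] at h3
  calc _ ≤ (n : ℝ) ^ b * (#G * ((n - (b + (t + 1)))! : ℝ)) := by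
        rw [← Nat.cast_mul]
        exact mul_le_mul_of_nonneg_left (Nat.cast_le.2 (h2.trans h1)) (by positivity)
    _ ≤ (n : ℝ) ^ b * (((n : ℝ) ^ (t + 1) * w) * ((n - (b + (t + 1)))! : ℝ)) := by gcongr
    _ = w * ((n : ℝ) ^ (b + (t + 1)) * ((n - (b + (t + 1)))! : ℝ)) := by rw [pow_add]; ring
    _ ≤ w * (2 * (n ! : ℝ)) := by
        have : Nonempty W := Fintype.card_pos_iff.1 (by rw [← hn', hn]; omega)
        have : 0 ≤ w := le_trans (Nat.cast_nonneg _) (hA fun _ => Classical.arbitrary W)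
        gcongr
    _ = _ := by ring

/-- Every small set has few blocks that are not rich with respect to it, and the exceptional block
is rich with respect to the first vertices of most blocks. -/
structure GoodOrder (E : Finset W → Prop) (d l t : ℕ) (θ : ℝ) (x x' : ℕ) (σ : Pos b M c ≃ W) :
    Prop where
  few_not_rich : ∀ T : Finset W, #T ≤ t + 1 → #{j | ¬ Rich E d l t θ T (block σ j)} < x
  few_not_rich_base :
    #{j | ¬ Rich E d l t θ (insert (apex σ) (part t σ j)) (base σ)} < x'

/-- Each of the two defining properties fails for at most a quarter of the orderings: the first by a
union bound over all `T`, the second by Markov's inequality. -/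
theorem factorial_le_two_mul_card_goodOrder (E : Finset W → Prop) (d l t : ℕ) (θ : ℝ) (x x' : ℕ)
    (hc : 4 ≤ c) (hcb : c ≤ b) (ht : t ≤ c) (hn : Fintype.card W = b + 1 + M * c)
    (hrc : ∀ T : Finset W, #T ≤ t + 1 → (c : ℝ) ^ 6 * #{g : Fin c → W | Function.Injective g ∧
        ¬ Rich E d l t θ T (univ.image g)} ≤ (Fintype.card W : ℝ) ^ c)
    (hrb : ∀ T : Finset W, #T ≤ t + 1 → (b : ℝ) ^ 6 * #{g : Fin b → W | Function.Injective g ∧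
        ¬ Rich E d l t θ T (univ.image g)} ≤ (Fintype.card W : ℝ) ^ b)
    (hx : 0 < x) (hxn : 2 * x * c ^ 2 ≤ Fintype.card W) (hM : M ≤ x * c ^ 4)
    (hpow : 4 * (Fintype.card W) ^ (t + 1) ≤ 2 ^ x)
    (hbn : 2 * (b + (t + 1)) ^ 2 ≤ Fintype.card W) (hM' : M ≤ x' * c ^ 2) (hx' : 0 < x') :
    ((Fintype.card W)! : ℝ) ≤ 2 * #{σ : Pos b M c ≃ W | GoodOrder E d l t θ x x' σ} := by
  set n := Fintype.card W with hn'
  let A : Finset W → Finset (Fin c → W) := fun T =>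
    {g | Function.Injective g ∧ ¬ Rich E d l t θ T (univ.image g)}
  let bad₁ : Finset W → Finset (Pos b M c ≃ W) := fun T =>
    {σ | x ≤ #{j : Fin M | (fun a => σ (Sum.inr (j, a))) ∈ A T}}
  let bad₂ : Finset (Pos b M c ≃ W) :=
    {σ | x' ≤ #{j | ¬ Rich E d l t θ (insert (apex σ) (part t σ j)) (base σ)}}
  have hcR : (4 : ℝ) ≤ c := by exact_mod_cast hc
  have hnf : (0 : ℝ) < (n ! : ℝ) := by positivity
  have h₁ : ∀ T ∈ powersetCard (t + 1) (univ : Finset W),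
      (2 : ℝ) ^ x * #(bad₁ T) ≤ (n ! : ℝ) := fun T hT =>
    card_many_blocks_mem_le (A T) x hc hx hn
      (hrc T (Finset.mem_powersetCard.1 hT).2.le) hxn hM
  have h₁' : 4 * (#((powersetCard (t + 1) (univ : Finset W)).biUnion bad₁) : ℝ) ≤ (n ! : ℝ) := by
    have h3 : (#((powersetCard (t + 1) (univ : Finset W)).biUnion bad₁) : ℝ) ≤
        n.choose (t + 1) • ((n ! : ℝ) / 2 ^ x) := by
      have h4 : (#((powersetCard (t + 1) (univ : Finset W)).biUnion bad₁) : ℝ) ≤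
          ∑ T ∈ powersetCard (t + 1) (univ : Finset W), (#(bad₁ T) : ℝ) := by
        exact_mod_cast Finset.card_biUnion_le
      refine h4.trans ((Finset.sum_le_card_nsmul _ _ ((n ! : ℝ) / 2 ^ x) fun T hT => ?_).trans_eq ?_)
      · rw [le_div_iff₀' (by positivity)]
        exact h₁ T hT
      · rw [Finset.card_powersetCard, Finset.card_univ]
    rw [nsmul_eq_mul] at h3
    have h5 : (4 : ℝ) * n.choose (t + 1) ≤ 2 ^ x := by
      have : 4 * n.choose (t + 1) ≤ 2 ^ x :=
        (Nat.mul_le_mul_left 4 (Nat.choose_le_pow n (t + 1))).trans hpow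
      exact_mod_cast this
    calc 4 * (#((powersetCard (t + 1) (univ : Finset W)).biUnion bad₁) : ℝ)
        ≤ 4 * (n.choose (t + 1) * ((n ! : ℝ) / 2 ^ x)) := by gcongr
      _ = (4 * n.choose (t + 1)) * ((n ! : ℝ) / 2 ^ x) := by ring
      _ ≤ 2 ^ x * ((n ! : ℝ) / 2 ^ x) := by gcongr
      _ = _ := by field_simp
  have h₂ : 4 * (#bad₂ : ℝ) ≤ (n ! : ℝ) := by
    have hj : ∀ j : Fin M, (#{σ : Pos b M c ≃ W |
        ¬ Rich E d l t θ (insert (apex σ) (part t σ j)) (base σ)} : ℝ) ≤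
        2 / (b : ℝ) ^ 6 * (n ! : ℝ) := by
      intro j
      have hbR : (0 : ℝ) < b := by exact_mod_cast (show 0 < b by omega)
      have hnR : (0 : ℝ) < n := by exact_mod_cast (show 0 < n by omega)
      have h3 := card_base_mem_le (b := b) ht j hn
        (fun τ => {g | Function.Injective g ∧ ¬ Rich E d l t θ (univ.image τ) (univ.image g)})
        ((n : ℝ) ^ b / (b : ℝ) ^ 6) (fun τ => by
          rw [le_div_iff₀' (by positivity)]
          refine hrb _ (Finset.card_image_le.trans ?_)
          simp) hbn
      refine le_of_mul_le_mul_left ?_ (show (0 : ℝ) < (n : ℝ) ^ b by positivity)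
      refine le_trans ?_ (h3.trans_eq ?_)
      · refine mul_le_mul_of_nonneg_left (Nat.cast_le.2 (Finset.card_le_card fun σ hσ => ?_))
          (by positivity)
        simp only [Finset.mem_filter, Finset.mem_univ, true_and] at hσ ⊢
        refine ⟨fun a a' h => by simpa using h, ?_⟩
        have hT : univ.image (Fin.cons (σ (Sum.inl none)) fun a => σ (Sum.inr (j, Fin.castLE ht a))
            : Fin (t + 1) → W) = insert (apex σ) (part t σ j) := by
          ext w
          simp only [Finset.mem_image, Finset.mem_univ, true_and, Finset.mem_insert, apex, part,
            Finset.mem_filter, Fin.exists_fin_succ, Fin.cons_zero, Fin.cons_succ]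
          refine or_congr eq_comm ⟨?_, ?_⟩
          · rintro ⟨a, rfl⟩
            exact ⟨Fin.castLE ht a, by simp, rfl⟩
          · rintro ⟨a, ha, rfl⟩
            exact ⟨⟨a, ha⟩, rfl⟩
        rw [hT]
        exact hσ
      · rw [← hn']
        field_simp
    -- Markov's inequality, by double counting pairs of an ordering and a block. The bound `b^(-6)`
    -- would not survive a union bound over all sets `T`.
    have h3 : (x' : ℝ) * #bad₂ ≤ M * (2 / (b : ℝ) ^ 6 * (n ! : ℝ)) := by
      calc (x' : ℝ) * #bad₂ = ∑ σ ∈ bad₂, (x' : ℝ) := by simp [mul_comm]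
        _ ≤ ∑ σ ∈ bad₂, (#{j | ¬ Rich E d l t θ (insert (apex σ) (part t σ j)) (base σ)} : ℝ) :=
            Finset.sum_le_sum fun σ hσ => by exact_mod_cast (Finset.mem_filter.1 hσ).2
        _ ≤ ∑ σ : Pos b M c ≃ W,
            (#{j | ¬ Rich E d l t θ (insert (apex σ) (part t σ j)) (base σ)} : ℝ) :=
            Finset.sum_le_sum_of_subset_of_nonneg (Finset.subset_univ _) fun _ _ _ => by positivity
        _ = ∑ j : Fin M, (#{σ : Pos b M c ≃ W |
              ¬ Rich E d l t θ (insert (apex σ) (part t σ j)) (base σ)} : ℝ) := by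
            simp only [Finset.card_filter]
            push_cast
            exact Finset.sum_comm
        _ ≤ ∑ j : Fin M, 2 / (b : ℝ) ^ 6 * (n ! : ℝ) := Finset.sum_le_sum fun j _ => hj j
        _ = _ := by simp
    have hx'R : (0 : ℝ) < x' := by exact_mod_cast hx'
    refine le_of_mul_le_mul_left ?_ hx'R
    have hMR : (M : ℝ) ≤ x' * c ^ 2 := by exact_mod_cast hM'
    have hbc : (c : ℝ) ≤ b := by exact_mod_cast hcb
    calc (x' : ℝ) * (4 * #bad₂) = 4 * (x' * #bad₂) := by ring
      _ ≤ 4 * ((x' * c ^ 2) * (2 / (c : ℝ) ^ 6 * (n ! : ℝ))) := by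
          refine mul_le_mul_of_nonneg_left (h3.trans ?_) (by norm_num)
          gcongr
      _ = (8 / (c : ℝ) ^ 4) * (x' * (n ! : ℝ)) := by field_simp; ring
      _ ≤ 1 * (x' * (n ! : ℝ)) := by
          gcongr
          rw [div_le_one (by positivity)]
          calc (8 : ℝ) ≤ 4 ^ 4 := by norm_num
            _ ≤ _ := by gcongr
      _ = _ := one_mul _
  have hcover : (univ : Finset (Pos b M c ≃ W)) ⊆
      (univ.filter fun σ : Pos b M c ≃ W => GoodOrder E d l t θ x x' σ) ∪
        ((powersetCard (t + 1) (univ : Finset W)).biUnion bad₁ ∪ bad₂) := by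
    intro σ _
    by_contra hσ
    simp only [Finset.mem_union, not_or, Finset.mem_filter, Finset.mem_univ, true_and, bad₂,
      Finset.mem_biUnion, bad₁, not_exists, not_and, not_le] at hσ
    refine hσ.1 ⟨fun T hT => ?_, hσ.2.2⟩
    have hnt : t + 1 ≤ n := by nlinarith
    -- Sets of size exactly `t + 1` suffice, because richness is inherited by smaller sets `T`.
    obtain ⟨T', hTT', hT'⟩ := Finset.exists_superset_card_eq hT (by simpa using hnt)
    refine lt_of_le_of_lt (Finset.card_le_card fun j hj => ?_)
      (hσ.2.1 T' (Finset.mem_powersetCard.2 ⟨Finset.subset_univ _, hT'⟩))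
    simp only [Finset.mem_filter, Finset.mem_univ, true_and, A] at hj ⊢
    refine ⟨fun a a' h => by simpa using h, fun h => hj (Rich.mono h hTT')⟩
  have hcard : Fintype.card (Pos b M c ≃ W) = n ! := by
    have hP : Fintype.card (Pos b M c) = Fintype.card W := by simp [← hn', hn]
    rw [Fintype.card_equiv (Fintype.equivOfCardEq hP), hP]
  have h4 : (n ! : ℝ) ≤ #{σ : Pos b M c ≃ W | GoodOrder E d l t θ x x' σ} +
      (#((powersetCard (t + 1) (univ : Finset W)).biUnion bad₁) + #bad₂) := by
    have h5 := Finset.card_le_card hcover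
    rw [Finset.card_univ, hcard] at h5
    exact_mod_cast h5.trans ((Finset.card_union_le _ _).trans
      (Nat.add_le_add_left (Finset.card_union_le _ _) _))
  linarith

end

/-! ### Discarding the poor blocks and distributing their vertices -/

section

variable {W : Type} {b M c N : ℕ}

theorem disjoint_block (σ : Pos b M c ≃ W) {i j : Fin M} (h : i ≠ j) :
    Disjoint (block σ i) (block σ j) := by
  rw [Finset.disjoint_left]
  intro v hi hj
  simp only [block, Finset.mem_image, Finset.mem_univ, true_and] at hi hj
  obtain ⟨a, rfl⟩ := hi
  obtain ⟨a', h'⟩ := hj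
  simp only [EmbeddingLike.apply_eq_iff_eq, Sum.inr.injEq, Prod.mk.injEq] at h'
  exact h h'.1.symm

variable [Fintype W]

/-- A choice of `N` blocks to keep, and an enumeration of the vertices of the other blocks. -/
structure Layout (E : Finset W → Prop) (d l t : ℕ) (θ : ℝ) (N z z' : ℕ) (σ : Pos b M c ≃ W) where
  kept : Fin N ↪ Fin M
  loose : Fin N ↪ W
  exists_loose_iff : ∀ v, (∃ i, loose i = v) ↔ ∃ j, (∀ i, kept i ≠ j) ∧ v ∈ block σ j
  few_parts : ∀ i, #{j | ¬ Rich E d l t θ (part t σ j) (block σ (kept i))} < z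
  few_vertices : ∀ i, #{v | ¬ Rich E d l t θ {v} (block σ (kept i))} < z'

theorem card_heavy_le {I J : Type*} [Fintype I] [Fintype J] (R : I → J → Prop) {x z q : ℕ}
    (hx : ∀ i, #{j | ¬ R i j} ≤ x) (hz : 0 < z) (hq : 2 * (Fintype.card I * x) ≤ q * z) :
    2 * #{j | z ≤ #{i | ¬ R i j}} ≤ q := by
  have h1 : #{j | z ≤ #{i | ¬ R i j}} * z ≤ Fintype.card I * x := by
    calc #{j | z ≤ #{i | ¬ R i j}} * z = ∑ j ∈ {j | z ≤ #{i | ¬ R i j}}, z := by simp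
      _ ≤ ∑ j ∈ {j | z ≤ #{i | ¬ R i j}}, #{i | ¬ R i j} :=
          Finset.sum_le_sum fun j hj => (Finset.mem_filter.1 hj).2
      _ ≤ ∑ j, #{i | ¬ R i j} :=
          Finset.sum_le_sum_of_subset_of_nonneg (Finset.subset_univ _) fun _ _ _ => Nat.zero_le _
      _ = ∑ i, #{j | ¬ R i j} := by
          simp only [Finset.card_filter]
          exact Finset.sum_comm
      _ ≤ ∑ _i : I, x := Finset.sum_le_sum fun i _ => hx i
      _ = _ := by simp
  refine Nat.le_of_mul_le_mul_right (c := z) ?_ hz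
  nlinarith

/-- A good ordering bounds the failures seen from each vertex or part; double counting bounds the
blocks with many failures, at most `q/2` of each kind. So `N = M - q` blocks survive, and the
remaining `q` blocks contain exactly `cq = N` vertices, one for each kept block. -/
theorem exists_layout {E : Finset W → Prop} {d l t : ℕ} {θ : ℝ} {x x' z z' q : ℕ}
    {σ : Pos b M c ≃ W} (hσ : GoodOrder E d l t θ x x' σ) (htc : t ≤ c)
    (hz : 0 < z) (hz' : 0 < z') (hMq : M = N + q) (hN : N = c * q)
    (h₁ : 2 * (M * x) ≤ q * z) (h₂ : 2 * (Fintype.card W * x) ≤ q * z') :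
    Nonempty (Layout E d l t θ N z z' σ) := by
  let bad₁ : Finset (Fin M) := {j | z ≤ #{i | ¬ Rich E d l t θ (part t σ i) (block σ j)}}
  let bad₂ : Finset (Fin M) := {j | z' ≤ #{v | ¬ Rich E d l t θ {v} (block σ j)}}
  have hb₁ : 2 * #bad₁ ≤ q := card_heavy_le
    (fun i j => Rich E d l t θ (part t σ i) (block σ j)) (fun i =>
      (hσ.few_not_rich _ ((card_part htc σ i).le.trans (by omega))).le) hz (by simpa using h₁)
  have hb₂ : 2 * #bad₂ ≤ q := card_heavy_le
    (fun v j => Rich E d l t θ {v} (block σ j)) (fun v =>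
      (hσ.few_not_rich _ (by simp)).le) hz' h₂
  have hun : #(bad₁ ∪ bad₂) ≤ q := (Finset.card_union_le _ _).trans (by omega)
  obtain ⟨K, -, hK, hKN⟩ := Finset.exists_subsuperset_card_eq
    (Finset.empty_subset (bad₁ ∪ bad₂)ᶜ) (n := N) (by simp) (by
      rw [Finset.card_compl, Fintype.card_fin]; omega)
  let e := (Finset.equivFinOfCardEq hKN).symm
  let L : Finset W := Kᶜ.biUnion (block σ)
  have hL : #L = N := by
    rw [Finset.card_biUnion fun i _ j _ h => disjoint_block σ h]
    simp only [card_block, Finset.sum_const, Finset.card_compl, Fintype.card_fin, hKN, smul_eq_mul]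
    rw [show M - N = q by omega, hN, mul_comm]
  let w := (Finset.equivFinOfCardEq hL).symm
  have hmem : ∀ i, (e i : Fin M) ∉ bad₁ ∧ (e i : Fin M) ∉ bad₂ := fun i => by
    have := Finset.mem_compl.1 (hK (e i).2)
    rwa [Finset.mem_union, not_or] at this
  refine ⟨⟨e.toEmbedding.trans (Function.Embedding.subtype _),
    w.toEmbedding.trans (Function.Embedding.subtype _), fun v => ?_, fun i => ?_, fun i => ?_⟩⟩
  · have h3 : (∃ i, (w i : W) = v) ↔ v ∈ L := by
      constructor
      · rintro ⟨i, rfl⟩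
        exact (w i).2
      · exact fun h => ⟨w.symm ⟨v, h⟩, by simp⟩
    refine h3.trans ?_
    simp only [L, Finset.mem_biUnion, Finset.mem_compl]
    refine exists_congr fun j => and_congr_left fun _ => ?_
    constructor
    · rintro hj i rfl
      exact hj (e i).2
    · intro h hj
      exact h (e.symm ⟨j, hj⟩) (by simp)
  · have := (hmem i).1
    simpa [bad₁] using this
  · have := (hmem i).2
    simpa [bad₂] using this

/-- The clusters obtained from the kept blocks by adding one loose vertex to each. -/
noncomputable def clusters {E : Finset W → Prop} {d l t : ℕ} {θ : ℝ} {z z' : ℕ}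
    {σ : Pos b M c ≃ W} (Λ : Layout E d l t θ N z z' σ) (ρ π : Equiv.Perm (Fin N)) :
    Fin (N + 1) → Finset W :=
  Fin.cons (insert (apex σ) (base σ)) fun i =>
    insert (Λ.loose (π (ρ i))) (block σ (Λ.kept (ρ i)))

/-- The properties of a cluster partition required of every outcome. -/
def GoodPartition (E : Finset W → Prop) (d l t : ℕ) (θ ε : ℝ) (b c : ℕ)
    (U : Fin (N + 1) → Finset W) : Prop :=
  ∃ (S : Fin (N + 1) → Finset W) (u : Fin (N + 1) → W) (T : Fin (N + 1) → Finset W)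
    (nb : Fin (N + 1) → Finset (Fin (N + 1))),
    (∀ i, U i = insert (u i) (S i) ∧ u i ∉ S i) ∧ (∀ i j, i ≠ j → Disjoint (U i) (U j)) ∧
    (∀ v, ∃ i, v ∈ U i) ∧ #(S 0) = b ∧ (∀ i : Fin N, #(S i.succ) = c) ∧
    ∀ i, Rich E d l t θ {u i} (S i) ∧ T i ⊆ S i ∧ #(T i) = t ∧ i ∉ nb i ∧
      (1 - ε) * ((N : ℝ) + 1) ≤ #(nb i) ∧
      ∀ j ∈ nb i, Rich E d l t θ (T j) (S i) ∧ Rich E d l t θ (T i) (S j)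

variable {E : Finset W → Prop} {d l t : ℕ} {θ : ℝ} {x x' z z' : ℕ} {σ : Pos b M c ≃ W}

theorem Layout.disjoint_clusters (Λ : Layout E d l t θ N z z' σ) (ρ π : Equiv.Perm (Fin N))
    {i j : Fin (N + 1)} (hij : i ≠ j) : Disjoint (clusters Λ ρ π i) (clusters Λ ρ π j) := by
  have hbase : ∀ j : Fin M, Disjoint (insert (apex σ) (base σ)) (block σ j) := by
    intro j
    rw [Finset.disjoint_left]
    intro v hv hv'
    simp only [block, base, apex, Finset.mem_insert, Finset.mem_image, Finset.mem_univ,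
      true_and] at hv hv'
    obtain ⟨a, rfl⟩ := hv'
    rcases hv with h | ⟨a', h⟩ <;> simp at h
  have hloose : ∀ k, ∃ j, (∀ i, Λ.kept i ≠ j) ∧ Λ.loose k ∈ block σ j := fun k =>
    (Λ.exists_loose_iff _).1 ⟨k, rfl⟩
  have h0 : ∀ i : Fin N, Disjoint (clusters Λ ρ π 0) (clusters Λ ρ π i.succ) := by
    intro i
    simp only [clusters, Fin.cons_zero, Fin.cons_succ]
    rw [Finset.disjoint_insert_right]
    obtain ⟨j, -, hj⟩ := hloose (π (ρ i))
    exact ⟨fun h => Finset.disjoint_left.1 (hbase j) h hj, hbase _⟩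
  have hnot : ∀ k i, Λ.loose k ∉ block σ (Λ.kept i) := by
    intro k i h
    obtain ⟨j, hj, hj'⟩ := hloose k
    exact Finset.disjoint_left.1 (disjoint_block σ (hj i)) h hj'
  revert hij
  refine Fin.cases ?_ (fun i => ?_) i <;> refine Fin.cases ?_ (fun j => ?_) j <;> intro hij
  · exact absurd rfl hij
  · exact h0 j
  · exact (h0 i).symm
  · have hij' : i ≠ j := fun h => hij (by rw [h])
    simp only [clusters, Fin.cons_succ]
    rw [Finset.disjoint_insert_left, Finset.disjoint_insert_right, Finset.mem_insert, not_or]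
    refine ⟨⟨fun h => hij' ?_, hnot _ _⟩, hnot _ _, disjoint_block σ fun h => hij' ?_⟩
    · exact ρ.injective (π.injective (Λ.loose.injective h))
    · exact ρ.injective (Λ.kept.injective h)

theorem Layout.exists_mem_clusters (Λ : Layout E d l t θ N z z' σ) (ρ π : Equiv.Perm (Fin N))
    (v : W) : ∃ i, v ∈ clusters Λ ρ π i := by
  rcases h : σ.symm v with (_ | a) | ⟨j, a⟩
  · refine ⟨0, ?_⟩
    rw [Equiv.symm_apply_eq] at h
    simp [clusters, apex, h]
  · refine ⟨0, ?_⟩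
    rw [Equiv.symm_apply_eq] at h
    simp [clusters, base, h]
  · rw [Equiv.symm_apply_eq] at h
    have hv : v ∈ block σ j := by simp [block, h]
    by_cases hj : ∃ i, Λ.kept i = j
    · obtain ⟨i, rfl⟩ := hj
      refine ⟨(ρ.symm i).succ, ?_⟩
      simp [clusters, hv]
    · push Not at hj
      obtain ⟨k, rfl⟩ := (Λ.exists_loose_iff v).2 ⟨j, hj, hv⟩
      refine ⟨(ρ.symm (π.symm k)).succ, ?_⟩
      simp [clusters]

theorem le_card_filter_comp {I J : Type*} [Fintype I] [Fintype J] (f : I ↪ J) (R : J → Prop)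
    {x : ℕ} (hx : #{j | ¬ R j} ≤ x) : Fintype.card I ≤ #{i | R (f i)} + x := by
  have h1 : #{i | ¬ R (f i)} ≤ #{j | ¬ R j} :=
    Finset.card_le_card_of_injOn f (fun i hi => by simpa using hi) f.injective.injOn
  have h2 := Finset.card_filter_add_card_filter_not (s := (univ : Finset I)) fun i => R (f i)
  rw [Finset.card_univ] at h2
  omega

theorem card_filter_and_ge {I : Type*} [Fintype I] (R R' : I → Prop) [DecidablePred R]
    [DecidablePred R'] {x y m : ℕ}
    (h : m ≤ #{i | R i} + x) (h' : m ≤ #{i | R' i} + y) (hm : Fintype.card I = m) :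
    m ≤ #{i | R i ∧ R' i} + (x + y) := by
  have h1 := Finset.card_union_add_card_inter (univ.filter fun i => R i) (univ.filter fun i => R' i)
  have h2 : (univ.filter fun i => R i) ∩ (univ.filter fun i => R' i) = univ.filter fun i => R i ∧ R' i := by
    ext i
    simp
  have h3 := Finset.card_le_univ ((univ.filter fun i => R i) ∪ (univ.filter fun i => R' i))
  rw [h2] at h1
  omega

/-- A cluster is missing from the neighbourhood of `i` for one of four reasons: its block is not
rich towards `T i` (at most `x`), its part is bad for `S i` (at most `z + x'`, covering both kinds
of cluster), it is `i` itself, or it is the exceptional cluster, which is always left out. -/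
theorem Layout.goodPartition (Λ : Layout E d l t θ N z z' σ) (hσ : GoodOrder E d l t θ x x' σ)
    (htc : t ≤ c) (htb : t ≤ b) (ε : ℝ) (hx' : x' ≤ M)
    (hε : (x : ℝ) + z + x' + 2 ≤ ε * (N + 1)) (ρ π : Equiv.Perm (Fin N))
    (hπ : ∀ i, Rich E d l t θ {Λ.loose (π i)} (block σ (Λ.kept i))) :
    GoodPartition E d l t θ ε b c (clusters Λ ρ π) := by
  let κ : Fin N ↪ Fin M := ρ.toEmbedding.trans Λ.kept
  obtain ⟨T₀, -, hT₀, hT₀t⟩ := Finset.exists_subsuperset_card_eq (Finset.empty_subset (base σ))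
    (n := t) (by simp) (by rw [card_base]; exact htb)
  let T : Fin (N + 1) → Finset W := Fin.cons T₀ fun i => part t σ (κ i)
  let S : Fin (N + 1) → Finset W := Fin.cons (base σ) fun i => block σ (κ i)
  let u : Fin (N + 1) → W := Fin.cons (apex σ) fun i => Λ.loose (π (ρ i))
  let R : Fin (N + 1) → Fin (N + 1) → Prop := fun i j =>
    Rich E d l t θ (T j) (S i) ∧ Rich E d l t θ (T i) (S j)
  let nb : Fin (N + 1) → Finset (Fin (N + 1)) := fun i =>
    (univ.filter fun j : Fin N => j.succ ≠ i ∧ R i j.succ).map (Fin.succEmb N)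
  have hTS : ∀ i, T i ⊆ S i := by
    refine Fin.cases hT₀ fun i => ?_
    exact part_subset_block t σ _
  have hTt : ∀ i, #(T i) = t := by
    refine Fin.cases hT₀t fun i => ?_
    exact card_part htc σ _
  have hout : ∀ i, N ≤ #{j : Fin N | Rich E d l t θ (T i) (S j.succ)} + x := by
    intro i
    have h := le_card_filter_comp κ (fun j => Rich E d l t θ (T i) (block σ j))
      (hσ.few_not_rich (T i) (by rw [hTt]; omega)).le
    rw [Fintype.card_fin] at h
    exact h
  have hin : ∀ i, N ≤ #{j : Fin N | Rich E d l t θ (T j.succ) (S i)} + (z + x') := by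
    refine Fin.cases ?_ fun i => ?_
    · have h := le_card_filter_comp κ
        (fun j => Rich E d l t θ (insert (apex σ) (part t σ j)) (base σ)) hσ.few_not_rich_base.le
      rw [Fintype.card_fin] at h
      refine h.trans ?_
      have h2 : #{i : Fin N | Rich E d l t θ (insert (apex σ) (part t σ (κ i))) (base σ)} ≤
          #{j : Fin N | Rich E d l t θ (T j.succ) (S 0)} :=
        Finset.card_le_card fun j hj => by
          simp only [Finset.mem_filter, Finset.mem_univ, true_and] at hj ⊢
          exact hj.mono (Finset.subset_insert _ _)
      omega
    · have h := le_card_filter_comp κ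
        (fun j => Rich E d l t θ (part t σ j) (block σ (κ i))) (Λ.few_parts (ρ i)).le
      rw [Fintype.card_fin] at h
      refine h.trans ?_
      change #{j : Fin N | Rich E d l t θ (T j.succ) (S i.succ)} + z ≤ _
      omega
  -- For the exceptional cluster, fewer than `x' ≤ M` blocks are bad, so some block witnesses
  -- richness towards a set containing the apex.
  have hrich : ∀ i, Rich E d l t θ {u i} (S i) := by
    refine Fin.cases ?_ fun i => hπ (ρ i)
    have h : #{j | ¬ Rich E d l t θ (insert (apex σ) (part t σ j)) (base σ)} <
        #(univ : Finset (Fin M)) := by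
      rw [Finset.card_univ, Fintype.card_fin]
      exact hσ.few_not_rich_base.trans_le hx'
    obtain ⟨j, -, hj⟩ := Finset.exists_mem_notMem_of_card_lt_card h
    simp only [Finset.mem_filter, Finset.mem_univ, true_and, not_not] at hj
    exact hj.mono (by simp [u])
  have hU : ∀ i, clusters Λ ρ π i = insert (u i) (S i) :=
    Fin.cases rfl fun i => rfl
  have hu : ∀ i, u i ∉ S i := by
    refine Fin.cases ?_ fun i => ?_
    · simp [u, S, apex, base]
    · obtain ⟨j, hj, hj'⟩ := (Λ.exists_loose_iff _).1 ⟨π (ρ i), rfl⟩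
      exact fun h => Finset.disjoint_left.1 (disjoint_block σ (hj (ρ i))) h hj'
  refine ⟨S, u, T, nb, fun i => ⟨hU i, hu i⟩, fun i j hij => Λ.disjoint_clusters ρ π hij,
    Λ.exists_mem_clusters ρ π, card_base σ, fun i => card_block σ _, fun i =>
    ⟨hrich i, hTS i, hTt i, ?_, ?_, ?_⟩⟩
  · simp only [nb, Finset.mem_map, Finset.mem_filter, Finset.mem_univ, true_and, not_exists]
    exact fun j hj => hj.1.1 hj.2
  · have h1 := card_filter_and_ge (fun j : Fin N => Rich E d l t θ (T j.succ) (S i))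
      (fun j => Rich E d l t θ (T i) (S j.succ)) (hin i) (hout i) (Fintype.card_fin N)
    have h2 : N ≤ #{j : Fin N | j.succ ≠ i} + 1 := by
      have h3 := Finset.card_filter_add_card_filter_not (s := (univ : Finset (Fin N)))
        fun j => j.succ ≠ i
      have h4 : #{j : Fin N | ¬ j.succ ≠ i} ≤ 1 := by
        refine Finset.card_le_one.2 fun j hj j' hj' => ?_
        simp only [Finset.mem_filter, Finset.mem_univ, true_and, not_not] at hj hj'
        exact Fin.succ_injective _ (hj.trans hj'.symm)
      rw [Finset.card_univ, Fintype.card_fin] at h3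
      omega
    have h3 := card_filter_and_ge (fun j : Fin N => j.succ ≠ i)
      (fun j => Rich E d l t θ (T j.succ) (S i) ∧ Rich E d l t θ (T i) (S j.succ)) h2 h1
      (Fintype.card_fin N)
    have h4 : #(nb i) = #{j : Fin N | j.succ ≠ i ∧ Rich E d l t θ (T j.succ) (S i) ∧
        Rich E d l t θ (T i) (S j.succ)} := by
      simp only [nb, Finset.card_map, R]
    rw [← h4] at h3
    have h5 : (N : ℝ) ≤ #(nb i) + (1 + ((z : ℝ) + x' + x)) := by exact_mod_cast h3
    linarith
  · intro j hj
    simp only [nb, Finset.mem_map, Finset.mem_filter, Finset.mem_univ, true_and] at hj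
    obtain ⟨j, hj, rfl⟩ := hj
    exact hj.2

/-- The kept blocks and the loose vertices form a dense bipartite graph, which carries a spread
distribution on its perfect matchings. -/
theorem Layout.exists_spread_matching (Λ : Layout E d l t θ N z z' σ)
    (hσ : GoodOrder E d l t θ x x' σ) (hN : 0 < N) (hx : 4 * x ≤ N) (hz : 4 * z' ≤ N) :
    ∃ μ : PMF (Equiv.Perm (Fin N)),
      (∀ π ∈ μ.support, ∀ i, Rich E d l t θ {Λ.loose (π i)} (block σ (Λ.kept i))) ∧
      ∀ (I : Finset (Fin N)) (g : Fin N → Fin N),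
        μ.toOuterMeasure {π | ∀ i ∈ I, π i = g i} ≤ ENNReal.ofReal (2 * (60 / N) ^ #I) := by
  refine SpreadPartition.exists_spread_matching
    (G := fun i j => Rich E d l t θ {Λ.loose j} (block σ (Λ.kept i)))
    (fun i => ?_) (fun j => ?_) hN
  · have h := le_card_filter_comp Λ.loose
      (fun v => Rich E d l t θ {v} (block σ (Λ.kept i))) (Λ.few_vertices i).le
    rw [Fintype.card_fin] at h
    omega
  · have h := le_card_filter_comp Λ.kept
      (fun i => Rich E d l t θ {Λ.loose j} (block σ i))
      (hσ.few_not_rich {Λ.loose j} (by simp)).le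
    rw [Fintype.card_fin] at h
    omega

end

/-! ### Spreadness -/

section

variable {W : Type} [Fintype W] {b M c N : ℕ}

/-- The positions whose vertices are placed in the cluster `i` by the ordering itself, if the
blocks `h` are kept. -/
noncomputable def slot (b c : ℕ) (h : Fin N → Fin M) : Fin (N + 1) → Finset (Pos b M c) :=
  Fin.cons (univ.image Sum.inl) fun i => univ.image fun a => Sum.inr (h i, a)

theorem card_slot_le (hcb : c ≤ b + 1) (h : Fin N → Fin M) (i : Fin (N + 1)) :
    #(slot b c h i) ≤ b + 1 := by
  refine Fin.cases ?_ (fun i => ?_) i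
  · refine Finset.card_image_le.trans ?_
    simp
  · refine Finset.card_image_le.trans ?_
    simpa using hcb

/-- The event that the ordering places every vertex `y l` in the cluster `f l`. -/
theorem card_slot_event_mul_le {G L : Type*} [Fintype G] [Fintype L]
    (ord : G ↪ (Pos b M c ≃ W)) (κ : G → (Fin N ↪ Fin M)) (y : L ↪ W) (f : L → Fin (N + 1))
    (hcb : c ≤ b + 1) (hN : 0 < N) (hM0 : 0 < M) (hM : M ≤ 2 * N) :
    (#{ω : G × Equiv.Perm (Fin N) |
      ∀ l, (ord ω.1).symm (y l) ∈ slot b c (fun i => κ ω.1 (ω.2 i)) (f l)} : ℝ) *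
        (Fintype.card W : ℝ) ^ Fintype.card L ≤
      (18 * ((b : ℝ) + 1)) ^ Fintype.card L * (((Fintype.card W)! : ℝ) * (N ! : ℝ)) := by
  set n := Fintype.card W with hn
  set a := Fintype.card L with ha
  set I : Finset (Fin N) := {i | ∃ l, f l = i.succ} with hI
  have han : a ≤ n := Fintype.card_le_of_embedding y
  have hIN : #I ≤ N := by simpa using Finset.card_le_univ I
  have hIa : #I ≤ a := by
    have h : #I ≤ #(univ.image f) := by
      refine Finset.card_le_card_of_injOn Fin.succ (fun i hi => ?_) (Fin.succ_injective _).injOn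
      simpa [hI] using hi
    exact h.trans Finset.card_image_le
  -- The map `β` guesses the blocks behind the clusters that occur in `f`; the default outside `I`
  -- never matters. Fixing the guess turns the condition on `σ` into one that no longer refers to
  -- the layout.
  let ext : (I → Fin M) → Fin N → Fin M := fun β i => if hi : i ∈ I then β ⟨i, hi⟩ else ⟨0, hM0⟩
  let Sβ : (I → Fin M) → Finset (Pos b M c ≃ W) := fun β =>
    {σ | ∀ l, σ.symm (y l) ∈ slot b c (ext β) (f l)}
  let ev : (I → Fin M) → Finset (G × Equiv.Perm (Fin N)) := fun β =>
    {ω | ord ω.1 ∈ Sβ β ∧ ∀ i : I, κ ω.1 (ω.2 i) = β i}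
  have hsub : ({ω : G × Equiv.Perm (Fin N) |
      ∀ l, (ord ω.1).symm (y l) ∈ slot b c (fun i => κ ω.1 (ω.2 i)) (f l)} : Finset _) ⊆
      univ.biUnion ev := by
    intro ω hω
    simp only [Finset.mem_filter, Finset.mem_univ, true_and] at hω
    simp only [Finset.mem_biUnion, Finset.mem_univ, true_and, ev, Sβ, Finset.mem_filter]
    refine ⟨fun i => κ ω.1 (ω.2 i), fun l => ?_, fun i => rfl⟩
    have h := hω l
    rcases Fin.eq_zero_or_eq_succ (f l) with h0 | ⟨i, hi⟩
    · rw [h0] at h ⊢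
      exact h
    · have hiI : i ∈ I := by simpa [hI] using ⟨l, hi⟩
      rw [hi] at h ⊢
      simpa [slot, ext, hiI] using h
  have hSβ : ∀ β, #(Sβ β) ≤ (b + 1) ^ a * (n - a)! := fun β =>
    card_equiv_symm_mem_le y (fun l => slot b c (ext β) (f l)) (b + 1)
      fun l => card_slot_le hcb _ _
  -- For each ordering, at most `(N - #I)!` permutations `ρ` realise the guess `β`, however the kept
  -- blocks were chosen.
  have hev : ∀ β, #(ev β) ≤ ((b + 1) ^ a * (n - a)!) * (N - #I)! := by
    intro β
    have h1 : #(ev β) ≤ (N - #I)! * #(Sβ β) := by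
      refine (Finset.card_le_mul_card_image_of_maps_to
        (f := fun ω : G × Equiv.Perm (Fin N) => ω.1)
        (t := univ.filter fun g => ord g ∈ Sβ β) (fun ω hω => ?_) (N - #I)!
        fun g _ => ?_).trans (Nat.mul_le_mul_left _ ?_)
      · simpa using (Finset.mem_filter.1 hω).2.1
      · refine le_trans ?_ (card_perm_comp_eq_on_le (κ g) I β)
        refine Finset.card_le_card_of_injOn Prod.snd (fun ω hω => ?_) fun ω hω ω' hω' h => ?_
        · simp only [Finset.coe_filter, Set.mem_ofPred_eq, ev, Finset.mem_filter, Finset.mem_univ,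
            true_and] at hω ⊢
          rw [← hω.2]
          exact hω.1.2
        · simp only [Finset.coe_filter, Set.mem_ofPred_eq] at hω hω'
          exact Prod.ext (hω.2.trans hω'.2.symm) h
      · exact Finset.card_le_card_of_injOn ord (fun g hg => by simpa using hg)
          ord.injective.injOn
    exact h1.trans ((Nat.mul_le_mul_left _ (hSβ β)).trans_eq (mul_comm _ _))
  have htotal : (#{ω : G × Equiv.Perm (Fin N) |
      ∀ l, (ord ω.1).symm (y l) ∈ slot b c (fun i => κ ω.1 (ω.2 i)) (f l)} : ℝ) ≤
      (M : ℝ) ^ #I * ((((b : ℝ) + 1) ^ a * ((n - a)! : ℝ)) * ((N - #I)! : ℝ)) := by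
    have h2 : #{ω : G × Equiv.Perm (Fin N) |
        ∀ l, (ord ω.1).symm (y l) ∈ slot b c (fun i => κ ω.1 (ω.2 i)) (f l)} ≤
        M ^ #I * (((b + 1) ^ a * (n - a)!) * (N - #I)!) := by
      refine (Finset.card_le_card hsub).trans (Finset.card_biUnion_le.trans ?_)
      refine (Finset.sum_le_card_nsmul _ _ _ fun β _ => hev β).trans_eq ?_
      rw [Finset.card_univ, Fintype.card_fun, Fintype.card_fin, Fintype.card_coe, smul_eq_mul]
    have h3 : ((M ^ #I * (((b + 1) ^ a * (n - a)!) * (N - #I)!) : ℕ) : ℝ) =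
        (M : ℝ) ^ #I * ((((b : ℝ) + 1) ^ a * ((n - a)! : ℝ)) * ((N - #I)! : ℝ)) := by
      push_cast
      rfl
    rw [← h3]
    exact Nat.cast_le.2 h2
  have hNR : (0 : ℝ) < (N : ℝ) ^ #I := by
    have : (0 : ℝ) < N := by exact_mod_cast hN
    positivity
  have hMR : (M : ℝ) ≤ 2 * N := by exact_mod_cast hM
  have h1 := pow_mul_factorial_sub_le n a han
  have h2 := pow_mul_factorial_sub_le N #I hIN
  have he : Real.exp 1 ≤ 3 := by
    have := Real.exp_one_lt_d9
    linarith
  obtain ⟨F, hF⟩ : ∃ F : ℝ, F = ((n - a)! : ℝ) := ⟨_, rfl⟩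
  obtain ⟨F', hF'⟩ : ∃ F' : ℝ, F' = ((N - #I)! : ℝ) := ⟨_, rfl⟩
  have hF0 : 0 ≤ F := hF ▸ Nat.cast_nonneg _
  have hF0' : 0 ≤ F' := hF' ▸ Nat.cast_nonneg _
  rw [← hF, ← hF'] at htotal
  rw [← hF] at h1
  rw [← hF'] at h2
  clear_value n a
  refine le_of_mul_le_mul_right ?_ hNR
  calc (#{ω : G × Equiv.Perm (Fin N) |
      ∀ l, (ord ω.1).symm (y l) ∈ slot b c (fun i => κ ω.1 (ω.2 i)) (f l)} : ℝ) *
        (n : ℝ) ^ a * (N : ℝ) ^ #I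
      ≤ ((M : ℝ) ^ #I * ((((b : ℝ) + 1) ^ a * F) * F')) * (n : ℝ) ^ a * (N : ℝ) ^ #I := by
        gcongr
    _ = ((M : ℝ) ^ #I * ((b : ℝ) + 1) ^ a) * (((n : ℝ) ^ a * F) * ((N : ℝ) ^ #I * F')) := by ring
    _ ≤ ((2 * N : ℝ) ^ #I * ((b : ℝ) + 1) ^ a) *
        ((Real.exp 1 ^ a * (n ! : ℝ)) * (Real.exp 1 ^ #I * (N ! : ℝ))) := by
        gcongr
    _ ≤ ((2 * N : ℝ) ^ #I * ((b : ℝ) + 1) ^ a) *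
        (((3 : ℝ) ^ a * (n ! : ℝ)) * ((3 : ℝ) ^ #I * (N ! : ℝ))) := by gcongr
    _ = (6 : ℝ) ^ #I * (3 * ((b : ℝ) + 1)) ^ a * ((n ! : ℝ) * (N ! : ℝ)) * (N : ℝ) ^ #I := by
        rw [mul_pow, mul_pow, show (6 : ℝ) = 2 * 3 by norm_num, mul_pow]
        ring
    -- The guesses cost `6 = 2 · 3` per cluster, from `M ≤ 2N` and `e ≤ 3`, and there are at most as
    -- many clusters as prescribed vertices.
    _ ≤ (6 : ℝ) ^ a * (3 * ((b : ℝ) + 1)) ^ a * ((n ! : ℝ) * (N ! : ℝ)) * (N : ℝ) ^ #I := by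
        gcongr
        norm_num
    _ = _ := by
        rw [← mul_pow]
        ring_nf

end

section

variable {W : Type} [Fintype W] {b M c N : ℕ}
  {E : Finset W → Prop} {d l t : ℕ} {θ : ℝ} {z z' : ℕ}

theorem Layout.matching_event_le {σ : Pos b M c ≃ W} (Λ : Layout E d l t θ N z z' σ)
    (ρ : Equiv.Perm (Fin N)) (μ : PMF (Equiv.Perm (Fin N)))
    (hμ : ∀ (I : Finset (Fin N)) (g : Fin N → Fin N),
      μ.toOuterMeasure {π | ∀ i ∈ I, π i = g i} ≤ ENNReal.ofReal (2 * (60 / N) ^ #I))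
    {s : ℕ} (y : Fin s ↪ W) (f : Fin s → Fin (N + 1)) (B : Finset (Fin s)) :
    μ.toOuterMeasure {π | ∀ l ∈ B, ∃ i, f l = i.succ ∧ Λ.loose (π (ρ i)) = y l} ≤
      ENNReal.ofReal (2 * (60 / N) ^ #B) := by
  rcases Set.eq_empty_or_nonempty
    {π : Equiv.Perm (Fin N) | ∀ l ∈ B, ∃ i, f l = i.succ ∧ Λ.loose (π (ρ i)) = y l}
    with h | ⟨π₀, hπ₀⟩
  · rw [h]
    simp
  -- If one matching `π₀` realises the event, all others that do must agree with it on `I`. Distinct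
  -- vertices `y l` force distinct indices, so `I` has as many elements as `B`.
  choose i hi hi' using fun l : B => hπ₀ l l.2
  let I : Finset (Fin N) := univ.image fun l : B => ρ (i l)
  have hI : #I = #B := by
    rw [Finset.card_image_of_injective, Finset.card_univ, Fintype.card_coe]
    intro l l' h
    have h' : y l = y l' := by
      rw [← hi' l, ← hi' l']
      exact congrArg (fun k => Λ.loose (π₀ k)) h
    exact Subtype.ext (y.injective h')
  rw [← hI]
  refine le_trans (MeasureTheory.measure_mono fun π hπ => ?_) (hμ I π₀)
  simp only [Set.mem_ofPred_eq, I, Finset.forall_mem_image] at hπ ⊢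
  intro l _
  obtain ⟨k, hk, hk'⟩ := hπ l l.2
  have hki : k = i l := Fin.succ_injective _ (hk.symm.trans (hi l))
  rw [hki] at hk'
  exact Λ.loose.injective (hk'.trans (hi' l).symm)

theorem Layout.mem_clusters {σ : Pos b M c ≃ W} (Λ : Layout E d l t θ N z z' σ)
    (ρ π : Equiv.Perm (Fin N)) (v : W) (j : Fin (N + 1)) (h : v ∈ clusters Λ ρ π j) :
    σ.symm v ∈ slot b c (fun i => Λ.kept (ρ i)) j ∨
      ∃ i, j = i.succ ∧ Λ.loose (π (ρ i)) = v := by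
  rcases Fin.eq_zero_or_eq_succ j with rfl | ⟨i, rfl⟩
  · left
    simp only [clusters, Fin.cons_zero, Finset.mem_insert, apex, base, Finset.mem_image,
      Finset.mem_univ, true_and] at h
    rcases h with rfl | ⟨a, rfl⟩ <;> simp [slot]
  · simp only [clusters, Fin.cons_succ, Finset.mem_insert, block, Finset.mem_image,
      Finset.mem_univ, true_and] at h
    rcases h with rfl | ⟨a, rfl⟩
    · exact Or.inr ⟨i, rfl, rfl⟩
    · left
      simp [slot]

/-- Union bound over the set `A` of vertices put in their cluster by the ordering; those outside `A`
must be brought there by the matching. -/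
theorem Layout.cluster_event_le {σ : Pos b M c ≃ W} (Λ : Layout E d l t θ N z z' σ)
    (ρ : Equiv.Perm (Fin N)) (μ : PMF (Equiv.Perm (Fin N)))
    (hμ : ∀ (I : Finset (Fin N)) (g : Fin N → Fin N),
      μ.toOuterMeasure {π | ∀ i ∈ I, π i = g i} ≤ ENNReal.ofReal (2 * (60 / N) ^ #I))
    {s : ℕ} (y : Fin s ↪ W) (f : Fin s → Fin (N + 1)) :
    μ.toOuterMeasure {π | ∀ l, y l ∈ clusters Λ ρ π (f l)} ≤
      ENNReal.ofReal (∑ A : Finset (Fin s),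
        if ∀ l : A, σ.symm (y l) ∈ slot b c (fun i => Λ.kept (ρ i)) (f l) then
          2 * (60 / (N : ℝ)) ^ (s - #A) else 0) := by
  let ev : Finset (Fin s) → Set (Equiv.Perm (Fin N)) := fun A =>
    if ∀ l : A, σ.symm (y l) ∈ slot b c (fun i => Λ.kept (ρ i)) (f l) then
      {π | ∀ l ∈ Aᶜ, ∃ i, f l = i.succ ∧ Λ.loose (π (ρ i)) = y l} else ∅
  have hsub : {π | ∀ l, y l ∈ clusters Λ ρ π (f l)} ⊆
      ⋃ A ∈ (univ : Finset (Finset (Fin s))), ev A := by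
    intro π hπ
    let A : Finset (Fin s) := {l | σ.symm (y l) ∈ slot b c (fun i => Λ.kept (ρ i)) (f l)}
    have hA : ∀ l : A, σ.symm (y l) ∈ slot b c (fun i => Λ.kept (ρ i)) (f l) := fun l =>
      (Finset.mem_filter.1 l.2).2
    refine Set.mem_biUnion (x := A) (Finset.mem_univ A) ?_
    simp only [ev, if_pos hA]
    intro l hl
    have hl' : σ.symm (y l) ∉ slot b c (fun i => Λ.kept (ρ i)) (f l) := by
      simpa [A] using hl
    exact (Λ.mem_clusters ρ π (y l) (f l) (hπ l)).resolve_left hl'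
  refine (MeasureTheory.measure_mono hsub).trans
    ((MeasureTheory.measure_biUnion_finset_le _ _).trans ?_)
  rw [ENNReal.ofReal_sum_of_nonneg fun A _ => by split_ifs <;> positivity]
  refine Finset.sum_le_sum fun A _ => ?_
  simp only [ev]
  split_ifs
  · have h := Λ.matching_event_le ρ μ hμ y f Aᶜ
    rwa [Finset.card_compl, Fintype.card_fin] at h
  · simp

/-- A family of layouts of many orderings, together with spread matchings, gives a spread random
partition into clusters. -/
theorem exists_spread_law {G : Type} [Fintype G] [Nonempty G]
    (ord : G ↪ (Pos b M c ≃ W)) (Λ : ∀ g, Layout E d l t θ N z z' (ord g))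
    (μ : G → PMF (Equiv.Perm (Fin N)))
    (hμ : ∀ g (I : Finset (Fin N)) (h : Fin N → Fin N),
      (μ g).toOuterMeasure {π | ∀ i ∈ I, π i = h i} ≤ ENNReal.ofReal (2 * (60 / N) ^ #I))
    (hG : ((Fintype.card W)! : ℝ) ≤ 2 * Fintype.card G) (hcb : c ≤ b + 1) (hN : 0 < N)
    (hM0 : 0 < M) (hM : M ≤ 2 * N) (hn : 0 < Fintype.card W) (w : ℝ)
    (hw : (Fintype.card W : ℝ) ≤ w * N) (hw0 : 0 ≤ w) :
    ∃ P : PMF (Fin (N + 1) → Finset W),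
      (∀ U ∈ P.support, ∃ g ρ, ∃ π ∈ (μ g).support, U = clusters (Λ g) ρ π) ∧
      ∀ (s : ℕ) (y : Fin s ↪ W) (f : Fin s → Fin (N + 1)),
        P.toOuterMeasure {U | ∀ l, y l ∈ U (f l)} ≤
          ENNReal.ofReal ((8 * (18 * (b + 1) + 60 * w) / Fintype.card W) ^ s) := by
  set n := Fintype.card W with hn'
  let P : PMF (Fin (N + 1) → Finset W) :=
    (PMF.uniformOfFintype (G × Equiv.Perm (Fin N))).bind fun ω =>
      (μ ω.1).map (clusters (Λ ω.1) ω.2)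
  refine ⟨P, fun U hU => ?_, fun s y f => ?_⟩
  · simp only [P, PMF.mem_support_bind_iff, PMF.mem_support_map_iff] at hU
    obtain ⟨⟨g, ρ⟩, -, π, hπ, rfl⟩ := hU
    exact ⟨g, ρ, π, hπ, rfl⟩
  -- The constant `4` below is absorbed into `4 ^ s`, which requires `s` to be positive.
  rcases Nat.eq_zero_or_pos s with rfl | hs
  · simp only [pow_zero, ENNReal.ofReal_one]
    refine (MeasureTheory.measure_mono (Set.subset_univ _)).trans_eq ?_
    rw [PMF.toOuterMeasure_apply_eq_one_iff]
    exact Set.subset_univ _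
  have hnR : (0 : ℝ) < n := by exact_mod_cast hn
  have hNR : (0 : ℝ) < N := by exact_mod_cast hN
  have hGR : (0 : ℝ) < Fintype.card G := by exact_mod_cast Fintype.card_pos
  let Q : Finset (Fin s) → G × Equiv.Perm (Fin N) → Prop := fun A ω =>
    ∀ l : A, (ord ω.1).symm (y l) ∈ slot b c (fun i => (Λ ω.1).kept (ω.2 i)) (f l)
  have hΩ : (Fintype.card (G × Equiv.Perm (Fin N)) : ℝ) = Fintype.card G * (N ! : ℝ) := by
    rw [Fintype.card_prod, Fintype.card_perm, Fintype.card_fin]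
    push_cast
    rfl
  have hΩ0 : (0 : ℝ) < Fintype.card (G × Equiv.Perm (Fin N)) := by
    rw [hΩ]
    positivity
  have h1 : P.toOuterMeasure {U | ∀ l, y l ∈ U (f l)} ≤
      ENNReal.ofReal (∑ ω : G × Equiv.Perm (Fin N),
        (Fintype.card (G × Equiv.Perm (Fin N)) : ℝ)⁻¹ *
          ∑ A : Finset (Fin s), if Q A ω then 2 * (60 / (N : ℝ)) ^ (s - #A) else 0) := by
    simp only [P]
    rw [PMF.toOuterMeasure_bind_apply, tsum_fintype, ENNReal.ofReal_sum_of_nonneg fun ω _ =>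
      mul_nonneg (by positivity) (Finset.sum_nonneg fun A _ => by split_ifs <;> positivity)]
    refine Finset.sum_le_sum fun ω _ => ?_
    rw [PMF.uniformOfFintype_apply, ENNReal.ofReal_mul (by positivity),
      ENNReal.ofReal_inv_of_pos hΩ0, ENNReal.ofReal_natCast, PMF.toOuterMeasure_map_apply]
    gcongr
    exact (Λ ω.1).cluster_event_le ω.2 (μ ω.1) (hμ ω.1) y f
  refine h1.trans (ENNReal.ofReal_le_ofReal ?_)
  set K : ℝ := 18 * (b + 1) + 60 * w with hK
  have hK1 : 18 * ((b : ℝ) + 1) ≤ K := by linarith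
  have hK2 : 60 * w ≤ K := by
    have : (0 : ℝ) ≤ 18 * ((b : ℝ) + 1) := by positivity
    linarith
  have hK0 : 0 ≤ K := le_trans (by positivity) hK1
  -- The factor `2` is the price of restricting to the good orderings, which are at least half of
  -- all.
  have hQ : ∀ A : Finset (Fin s), (#{ω | Q A ω} : ℝ) ≤
      2 * (K / n) ^ #A * Fintype.card (G × Equiv.Perm (Fin N)) := by
    intro A
    have h2 := card_slot_event_mul_le ord (fun g => (Λ g).kept)
      ((Function.Embedding.subtype (· ∈ A)).trans y) (fun l => f l) hcb hN hM0 hM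
    rw [Fintype.card_coe] at h2
    have h3 : (#{ω | Q A ω} : ℝ) * (n : ℝ) ^ #A ≤
        (18 * ((b : ℝ) + 1)) ^ #A * ((n ! : ℝ) * (N ! : ℝ)) := h2
    rw [div_pow, hΩ, mul_div_assoc', div_mul_eq_mul_div, le_div_iff₀ (by positivity)]
    refine h3.trans ?_
    calc (18 * ((b : ℝ) + 1)) ^ #A * ((n ! : ℝ) * (N ! : ℝ))
        ≤ K ^ #A * ((2 * Fintype.card G) * (N ! : ℝ)) := by gcongr
      _ = _ := by ring
  have hN60 : 60 / (N : ℝ) ≤ K / n := by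
    rw [div_le_div_iff₀ hNR hnR]
    nlinarith
  calc ∑ ω : G × Equiv.Perm (Fin N), (Fintype.card (G × Equiv.Perm (Fin N)) : ℝ)⁻¹ *
          ∑ A : Finset (Fin s), (if Q A ω then 2 * (60 / (N : ℝ)) ^ (s - #A) else 0)
      = ∑ A : Finset (Fin s), (Fintype.card (G × Equiv.Perm (Fin N)) : ℝ)⁻¹ *
          (#{ω | Q A ω} * (2 * (60 / (N : ℝ)) ^ (s - #A))) := by
        simp_rw [Finset.mul_sum]
        rw [Finset.sum_comm]
        refine Finset.sum_congr rfl fun A _ => ?_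
        rw [← Finset.mul_sum, ← Finset.sum_filter, Finset.sum_const, nsmul_eq_mul]
    _ ≤ ∑ A : Finset (Fin s), (Fintype.card (G × Equiv.Perm (Fin N)) : ℝ)⁻¹ *
          ((2 * (K / n) ^ #A * Fintype.card (G × Equiv.Perm (Fin N))) *
            (2 * (K / n) ^ (s - #A))) := by
        refine Finset.sum_le_sum fun A _ => ?_
        have := hQ A
        gcongr
    _ = ∑ A : Finset (Fin s), 4 * (K / n) ^ s := by
        refine Finset.sum_congr rfl fun A _ => ?_
        have hA : #A ≤ s := by simpa using Finset.card_le_univ A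
        have hp : (K / n) ^ s = (K / n) ^ #A * (K / n) ^ (s - #A) := by
          rw [← pow_add, Nat.add_sub_cancel' hA]
        rw [hp]
        field_simp
        ring
    _ = 2 ^ s * 4 * (K / n) ^ s := by
        rw [Finset.sum_const, Finset.card_univ, Fintype.card_finset, Fintype.card_fin,
          nsmul_eq_mul]
        push_cast
        ring
    _ ≤ 2 ^ s * 4 ^ s * (K / n) ^ s := by
        gcongr
        exact le_self_pow₀ (by norm_num) (by omega)
    _ = _ := by
        rw [← mul_pow, ← mul_pow]
        congr 1
        ring

end

/-! ### Choice of the parameters -/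

theorem eventually_mul_pow_le_two_pow (A k : ℕ) :
    ∃ v₀ : ℕ, ∀ v : ℕ, v₀ ≤ v → A * (v + 1) ^ k ≤ 2 ^ v := by
  have h := ((tendsto_pow_const_div_const_pow_of_one_lt k (one_lt_two : (1 : ℝ) < 2)).comp
    (Filter.tendsto_add_atTop_nat 1)).eventually_lt_const
    (u := 1 / (2 * ((A : ℝ) + 1))) (by positivity)
  obtain ⟨v₀, hv₀⟩ := Filter.eventually_atTop.1 h
  refine ⟨v₀, fun v hv => ?_⟩
  have h1 := hv₀ v hv
  simp only [Function.comp_apply] at h1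
  rw [div_lt_div_iff₀ (by positivity) (by positivity), one_mul, pow_succ (2 : ℝ) v] at h1
  have h3 : (A : ℝ) * ((v : ℝ) + 1) ^ k ≤ 2 ^ v := by
    push_cast at h1
    have h4 : (0 : ℝ) ≤ ((v : ℝ) + 1) ^ k := by positivity
    nlinarith
  exact_mod_cast h3

-- Since `x` is about `q/c³` and `x'` about `q/c`, all error terms add up to at most `13q`, which is
-- below `ε N` as soon as `ε c ≥ 13`. As `x` is linear in `q` and `n` is at most a constant times
-- `q`, the power `2^x` beats the polynomial in `n`.
set_option maxHeartbeats 800000 in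
theorem exists_block_count (c t : ℕ) (ε : ℝ) (hc : 16 ≤ c) (hε : 13 ≤ ε * c) :
    ∃ q₀ : ℕ, 2 ≤ q₀ ∧ ∀ q : ℕ, q₀ ≤ q → ∀ n b x x' : ℕ, c * (c + 1) * (q + 1) ≤ n →
      n < c * (c + 1) * (q + 2) → b + 1 < 2 * (c * (c + 1)) →
      x = (c + 1) * q / c ^ 4 + 1 → x' = (c + 1) * q / c ^ 2 + 1 →
      2 * x * c ^ 2 ≤ n ∧ 4 * n ^ (t + 1) ≤ 2 ^ x ∧ 2 * (b + (t + 1)) ^ 2 ≤ n ∧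
      4 * x ≤ c * q ∧ 4 * (4 * c * (c + 1) * x) ≤ c * q ∧ x' ≤ (c + 1) * q ∧
      (x : ℝ) + (2 * (c + 1) * x : ℕ) + x' + 2 ≤ ε * ((c * q : ℕ) + 1) ∧
      n ≤ 2 * (c + 1) * (c * q) := by
  obtain ⟨v₀, hv₀⟩ := eventually_mul_pow_le_two_pow
    (4 * (2 * (c + 1) * c * c ^ 3) ^ (t + 1)) (t + 1)
  refine ⟨c ^ 3 * v₀ + 64 * c + 2 * (2 * (c * (c + 1)) + (t + 1)) ^ 2 + c ^ 2 + 3, by omega,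
    fun q hq n b x x' hn hn' hb hx hx' => ?_⟩
  have hcR : (16 : ℝ) ≤ c := by exact_mod_cast hc
  have hq1 : 64 * c ≤ q := by omega
  have hq2 : c ^ 2 + 3 ≤ q := by omega
  have hqR1 : (64 * c : ℝ) ≤ q := by exact_mod_cast hq1
  have hq0 : (0 : ℝ) ≤ q := by positivity
  have hxR : (x : ℝ) ≤ 2 * q / c ^ 3 + 1 := by
    have h1 : (((c + 1) * q / c ^ 4 : ℕ) : ℝ) ≤ ((c + 1) * q : ℕ) / ((c ^ 4 : ℕ) : ℝ) :=
      Nat.cast_div_le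
    have h2 : (((c + 1) * q : ℕ) : ℝ) / ((c ^ 4 : ℕ) : ℝ) ≤ 2 * q / c ^ 3 := by
      push_cast
      rw [div_le_div_iff₀ (by positivity) (by positivity)]
      have : ((c : ℝ) + 1) * q ≤ 2 * q * c := by nlinarith
      calc ((c : ℝ) + 1) * q * c ^ 3 ≤ 2 * q * c * c ^ 3 := by gcongr
        _ = _ := by ring
    rw [hx]
    push_cast at h1 h2 ⊢
    linarith
  have hxR' : (x' : ℝ) ≤ 2 * q / c + 1 := by
    have h1 : (((c + 1) * q / c ^ 2 : ℕ) : ℝ) ≤ ((c + 1) * q : ℕ) / ((c ^ 2 : ℕ) : ℝ) :=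
      Nat.cast_div_le
    have h2 : (((c + 1) * q : ℕ) : ℝ) / ((c ^ 2 : ℕ) : ℝ) ≤ 2 * q / c := by
      push_cast
      rw [div_le_div_iff₀ (by positivity) (by positivity)]
      have : ((c : ℝ) + 1) * q ≤ 2 * q * c := by nlinarith
      calc ((c : ℝ) + 1) * q * c ≤ 2 * q * c * c := by gcongr
        _ = _ := by ring
    rw [hx']
    push_cast at h1 h2 ⊢
    linarith
  have hqc : (q : ℝ) / c ≤ q / 16 := by gcongr
  have hqc2 : (q : ℝ) / c ^ 2 ≤ q / 16 / 16 := by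
    rw [pow_two, ← div_div]
    gcongr
  have hx2 : (x : ℝ) * c ^ 2 ≤ q / 8 + c ^ 2 := by
    calc (x : ℝ) * (c : ℝ) ^ 2 ≤ (2 * (q : ℝ) / (c : ℝ) ^ 3 + 1) * (c : ℝ) ^ 2 := by gcongr
      _ = 2 * ((q : ℝ) / c) + (c : ℝ) ^ 2 := by field_simp
      _ ≤ _ := by linarith
  have hx1 : ((c : ℝ) + 1) * x ≤ q / 64 + 2 * c := by
    calc ((c : ℝ) + 1) * x ≤ (2 * c) * (2 * q / c ^ 3 + 1) := by gcongr; linarith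
      _ = 4 * (q / c ^ 2) + 2 * c := by field_simp; ring
      _ ≤ _ := by linarith
  have hqn : q + 2 * c ^ 2 ≤ n := by
    refine le_trans ?_ hn
    have h1 : 2 ≤ q + 1 := by omega
    nlinarith [Nat.mul_le_mul (Nat.le_refl (c * (c + 1))) h1,
      Nat.mul_le_mul (show 256 ≤ c * (c + 1) by nlinarith) (Nat.le_refl q)]
  have hn2 : n ≤ 2 * (c + 1) * (c * q) := by
    have h1 : q + 2 ≤ 2 * q := by omega
    have h2 := Nat.mul_le_mul_left (c * (c + 1)) h1
    nlinarith
  have h7 : 4 * (4 * c * (c + 1) * x) ≤ c * q := by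
    have h1 : (16 * (((c : ℝ) + 1) * x)) ≤ q := by linarith
    have h2 : 16 * ((c + 1) * x) ≤ q := by exact_mod_cast h1
    nlinarith
  refine ⟨?_, ?_, ?_, ?_, h7, ?_, ?_, hn2⟩
  · have h1 : (2 * x * c ^ 2 : ℝ) ≤ (q + 2 * c ^ 2 : ℕ) := by
      push_cast
      nlinarith
    have h2 : 2 * x * c ^ 2 ≤ q + 2 * c ^ 2 := by exact_mod_cast h1
    exact h2.trans hqn
  · set v := q / c ^ 3 with hv
    have hc3 : 0 < c ^ 3 := by positivity
    have hv1 : v₀ ≤ v := by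
      rw [hv, Nat.le_div_iff_mul_le hc3, mul_comm]
      omega
    have hqv : q ≤ c ^ 3 * (v + 1) := (Nat.lt_mul_div_succ q hc3).le
    have hvx : v ≤ x := by
      have h1 : q * c ≤ (c + 1) * q := by nlinarith
      have h2 : v ≤ (c + 1) * q / c ^ 4 := by
        rw [Nat.le_div_iff_mul_le (by positivity)]
        calc v * c ^ 4 = (v * c ^ 3) * c := by ring
          _ ≤ q * c := Nat.mul_le_mul_right _ (Nat.div_mul_le_self _ _)
          _ ≤ _ := h1
      omega
    calc 4 * n ^ (t + 1) ≤ 4 * (2 * (c + 1) * (c * (c ^ 3 * (v + 1)))) ^ (t + 1) := by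
          refine Nat.mul_le_mul_left _ (Nat.pow_le_pow_left (hn2.trans ?_) _)
          gcongr
      _ = 4 * (2 * (c + 1) * c * c ^ 3) ^ (t + 1) * (v + 1) ^ (t + 1) := by
          rw [mul_assoc 4, ← mul_pow]
          ring
      _ ≤ 2 ^ v := hv₀ v hv1
      _ ≤ 2 ^ x := Nat.pow_le_pow_right (by norm_num) hvx
  · have h1 : 2 * (b + (t + 1)) ^ 2 ≤ 2 * (2 * (c * (c + 1)) + (t + 1)) ^ 2 := by
      refine Nat.mul_le_mul_left _ (Nat.pow_le_pow_left (by omega) _)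
    omega
  · refine le_trans ?_ h7
    refine Nat.mul_le_mul_left _ (Nat.le_mul_of_pos_left _ (by positivity))
  · have h1 : (c + 1) * q / c ^ 2 ≤ (c + 1) * q / 2 :=
      Nat.div_le_div_left (by nlinarith) (by norm_num)
    have h2 : 2 ≤ (c + 1) * q := by nlinarith
    omega
  · have h1 : (x : ℝ) ≤ ((c : ℝ) + 1) * x := by
      have : (0 : ℝ) ≤ x := by positivity
      nlinarith
    have h2 : (x' : ℝ) ≤ q / 8 + 1 := by
      have : 2 * (q : ℝ) / c = 2 * (q / c) := by ring
      linarith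
    have h3 : (x : ℝ) + (2 * (c + 1) * x : ℕ) + x' + 2 ≤ 13 * q := by
      push_cast
      have : (2 : ℝ) * (c + 1) * x = 2 * (((c : ℝ) + 1) * x) := by ring
      linarith
    refine h3.trans ?_
    push_cast
    have h4 : 0 ≤ ε := by
      by_contra h
      push Not at h
      nlinarith
    calc (13 : ℝ) * q ≤ (ε * c) * q := by gcongr
      _ ≤ _ := by nlinarith

/-- The random cluster partition, for hypergraphs given by a predicate on finite sets. -/
theorem exists_spread_goodPartition (d l t : ℕ) (hl : 1 ≤ l) (α ε : ℝ) (hα : 0 < α) (hα1 : α ≤ 1)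
    (hε : 0 < ε) :
    ∃ c₀ : ℕ, 1 ≤ c₀ ∧ ∀ c : ℕ, c₀ ≤ c → ∃ n₀ : ℕ, ∀ n : ℕ, n₀ ≤ n → ∀ δ : ℝ, 0 ≤ δ → δ ≤ 1 →
      ∀ (W : Type) [Fintype W], Fintype.card W = n → ∀ E : Finset W → Prop,
      (∀ D : Finset W, #D = d → (δ + 3 / 4 * α) * (n : ℝ) ^ l ≤
        #{x : Fin l → W | E (D ∪ univ.image x)}) →
      ∃ (N b : ℕ) (P : PMF (Fin (N + 1) → Finset W)),
        b + 1 = c * (c + 1) + n % (c * (c + 1)) ∧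
        (∀ U ∈ P.support, GoodPartition E d l t (δ + α / 2) ε b c U) ∧
        ∀ (s : ℕ) (y : Fin s ↪ W) (f : Fin s → Fin (N + 1)),
          P.toOuterMeasure {U | ∀ i, y i ∈ U (f i)} ≤
            ENNReal.ofReal ((8 * (36 * (c * (c + 1)) + 120 * (c + 1)) / n) ^ s) := by
  obtain ⟨c₁, hc₁⟩ := exists_card_not_rich_le d l t 6 hl α hα hα1
  refine ⟨c₁ + 16 + t + ⌈13 / ε⌉₊, by omega, fun c hc => ?_⟩
  have hεc : 13 ≤ ε * c := by
    have h1 : (13 / ε : ℝ) ≤ c := (Nat.le_ceil _).trans (by exact_mod_cast (by omega))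
    rw [div_le_iff₀ hε] at h1
    linarith
  obtain ⟨q₀, hq₀2, hq₀⟩ := exists_block_count c t ε (by omega) hεc
  refine ⟨c * (c + 1) * (q₀ + 1), fun n hn δ hδ hδ1 W _ hWn E hE => ?_⟩
  have hcc : 0 < c * (c + 1) := Nat.mul_pos (by omega) (by omega)
  set r := n % (c * (c + 1)) with hr
  have hrlt : r < c * (c + 1) := Nat.mod_lt _ hcc
  obtain ⟨q, hq⟩ : ∃ q, n / (c * (c + 1)) = q + 1 := by
    refine ⟨n / (c * (c + 1)) - 1, ?_⟩
    have : q₀ + 1 ≤ n / (c * (c + 1)) := by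
      rw [Nat.le_div_iff_mul_le hcc, mul_comm]
      exact hn
    omega
  have hqq : q₀ ≤ q := by
    have : q₀ + 1 ≤ n / (c * (c + 1)) := by
      rw [Nat.le_div_iff_mul_le hcc, mul_comm]
      exact hn
    omega
  have hnq : n = c * (c + 1) * (q + 1) + r := by
    rw [← hq, hr]
    exact (Nat.div_add_mod _ _).symm
  -- One of the `q + 1` groups of `c(c+1)` vertices goes with the remainder into the exceptional
  -- cluster. This makes `b ≥ c`, so the sampling bound for large samples covers that cluster too.
  obtain ⟨b, hb⟩ : ∃ b, b + 1 = c * (c + 1) + r := ⟨c * (c + 1) + r - 1, by omega⟩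
  have hcb : c ≤ b := by nlinarith
  set M := (c + 1) * q with hM
  set N := c * q with hN
  set x := M / c ^ 4 + 1 with hx
  set x' := M / c ^ 2 + 1 with hx'
  have hn' : Fintype.card W = b + 1 + M * c := by
    rw [hWn, hb, hnq, hM]
    ring
  obtain ⟨p1, p2, p3, p4, p5, p6, p7, p8⟩ := hq₀ q hqq n b x x' (by omega)
    (by rw [hnq]; nlinarith) (by omega) rfl rfl
  have hc4 : 0 < c ^ 4 := Nat.pow_pos (by omega)
  have hc2 : 0 < c ^ 2 := Nat.pow_pos (by omega)
  have hMx : M ≤ x * c ^ 4 := by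
    rw [hx, mul_comm]
    exact (Nat.lt_mul_div_succ M hc4).le
  have hMx' : M ≤ x' * c ^ 2 := by
    rw [hx', mul_comm]
    exact (Nat.lt_mul_div_succ M hc2).le
  have hq0 : 0 < q := by omega
  have hN0 : 0 < N := Nat.mul_pos (by omega) hq0
  have hM0 : 0 < M := Nat.mul_pos (by omega) hq0
  have hE' : ∀ D : Finset W, #D = d → (δ + 3 / 4 * α) * (Fintype.card W : ℝ) ^ l ≤
      #{x : Fin l → W | E (D ∪ univ.image x)} := by
    simpa [hWn] using hE
  have hgood := factorial_le_two_mul_card_goodOrder (b := b) (M := M) (c := c) E d l t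
    (δ + α / 2) x x' (by omega) hcb (by omega) hn'
    (fun T hT => hc₁ c (by omega) δ hδ hδ1 W E hE' T hT)
    (fun T hT => hc₁ b (by omega) δ hδ hδ1 W E hE' T hT)
    (Nat.succ_pos _) (by rwa [hWn]) hMx (by rwa [hWn])
    (by rwa [hWn]) hMx' (Nat.succ_pos _)
  let G : Type := {σ : Pos b M c ≃ W // GoodOrder E d l t (δ + α / 2) x x' σ}
  have hGcard : (((Fintype.card W)! : ℕ) : ℝ) ≤ 2 * Fintype.card G := by
    refine hgood.trans_eq ?_
    rw [Fintype.card_subtype]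
  have hGne : Nonempty G := by
    rw [← Fintype.card_pos_iff]
    have h1 : (0 : ℝ) < (((Fintype.card W)! : ℕ) : ℝ) := by positivity
    have h2 : (0 : ℝ) < Fintype.card G := by linarith
    exact_mod_cast h2
  -- The thresholds solve `2Mx = q z` with `M = (c+1)q`, and `2nx ≤ q z'` with `n ≤ 2(c+1)cq`.
  have hlay : ∀ g : G, Nonempty (Layout E d l t (δ + α / 2) N (2 * (c + 1) * x)
      (4 * c * (c + 1) * x) g.1) := fun g =>
    exists_layout (q := q) g.2 (by omega) (by positivity) (by
      have : 0 < c := by omega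
      positivity) (by rw [hM, hN]; ring) hN
      (by rw [hM]; exact le_of_eq (by ring))
      (by
        rw [hWn]
        calc 2 * (n * x) ≤ 2 * (2 * (c + 1) * N * x) := by gcongr
          _ = _ := by rw [hN]; ring)
  let Λ : ∀ g : G, Layout E d l t (δ + α / 2) N (2 * (c + 1) * x) (4 * c * (c + 1) * x) g.1 :=
    fun g => (hlay g).some
  choose μ hμ hμ' using fun g : G => (Λ g).exists_spread_matching g.2 hN0 p4 p5
  obtain ⟨P, hP, hP'⟩ := exists_spread_law (Function.Embedding.subtype _) Λ μ hμ' hGcard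
    (by omega) hN0 hM0 (by
      rw [hM, hN, ← mul_assoc]
      exact Nat.mul_le_mul_right _ (by omega)) (by rw [hn']; omega)
    (2 * ((c : ℝ) + 1)) (by
      rw [hWn]
      exact_mod_cast p8) (by positivity)
  refine ⟨N, b, P, hb, fun U hU => ?_, fun s y f => ?_⟩
  · obtain ⟨g, ρ, π, hπ, rfl⟩ := hP U hU
    exact (Λ g).goodPartition g.2 (by omega) (by omega) ε p6 p7 ρ π (hμ g π hπ)
  · refine (hP' s y f).trans (ENNReal.ofReal_le_ofReal ?_)
    rw [hWn]
    have h1 : (b : ℝ) + 1 ≤ 2 * (c * (c + 1)) := by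
      have : b + 1 ≤ 2 * (c * (c + 1)) := by omega
      exact_mod_cast this
    gcongr ((8 * ?_) / _) ^ s
    linarith

/-! ### Transfer to hypergraphs -/

section

variable {V : Type*} {H : Hypergraph V} {W : Type} {k d l : ℕ}

/-- The edges of `H`, as a predicate on finite sets of labels. -/
def EdgeLabels {W : Type} (H : Hypergraph V) (ν : W ↪ V) (F : Finset W) : Prop :=
  ν '' (F : Set W) ∈ H.edgeSet

theorem card_eq_of_edgeLabels {ν : W ↪ V} (hk : H.IsUniform k) {F : Finset W}
    (hF : EdgeLabels H ν F) : #F = k := by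
  have h := hk _ hF
  rw [ν.injective.encard_image, Set.encard_coe_eq_coe_finsetCard] at h
  exact_mod_cast h

variable [Fintype W]

theorem exists_image_eq {ν : W ↪ V} {A : Finset W} {D : Set V}
    (hD : D ⊆ ν '' (A : Set W)) :
    ∃ D' : Finset W, D' ⊆ A ∧ ν '' (D' : Set W) = D := by
  obtain ⟨B, hB, rfl⟩ := Set.subset_image_iff.1 hD
  refine ⟨B.toFinset, fun i hi => hB (by simpa using hi), by simp⟩

/-- Every edge `A` containing `D` arises from the `l!` enumerations of `A \ D`. -/
theorem le_card_completions {ν : W ↪ V} (hν : Set.range ν = H.vertexSet)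
    (hk : H.IsUniform k) (hdl : d + l = k) {D : Finset W} (hD : #D = d) :
    H.minDegree d * l ! ≤ #{x : Fin l → W | EdgeLabels H ν (D ∪ univ.image x)} := by
  let F : Finset (Finset W) := {F | D ⊆ F ∧ EdgeLabels H ν F}
  have h1 : H.minDegree d ≤ H.degree (ν '' (D : Set W)) := by
    refine Nat.sInf_le ⟨_, ?_, ?_, rfl⟩
    · rw [← hν]
      exact Set.image_subset_range _ _
    · rw [ν.injective.encard_image, Set.encard_coe_eq_coe_finsetCard, hD]
  have h2 : H.degree (ν '' (D : Set W)) ≤ #F := by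
    rw [← Set.ncard_coe_finset]
    refine (Set.ncard_le_ncard (t := (fun F : Finset W => ν '' (F : Set W)) '' F)
      ?_ (Set.toFinite _)).trans (Set.ncard_image_le (Set.toFinite _))
    rintro e ⟨he, hDe⟩
    have he' : e ⊆ ν '' ((univ : Finset W) : Set W) := by
      rw [Finset.coe_univ, Set.image_univ, hν]
      exact H.subset_vertexSet_of_mem_edgeSet he
    obtain ⟨A, -, rfl⟩ := exists_image_eq he'
    refine ⟨A, ?_, rfl⟩
    simp only [F, Finset.coe_filter, Finset.mem_univ, true_and, Set.mem_ofPred_eq]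
    rw [Set.image_subset_image_iff ν.injective] at hDe
    exact ⟨by exact_mod_cast hDe, he⟩
  refine (Nat.mul_le_mul_right _ (h1.trans h2)).trans ?_
  rw [Finset.card_eq_sum_card_fiberwise (f := fun x : Fin l → W => D ∪ univ.image x) (t := F)
    fun x hx => by
      simp only [Finset.coe_filter, Finset.mem_univ, true_and, Set.mem_ofPred_eq, F] at hx ⊢
      exact ⟨Finset.subset_union_left, hx⟩]
  rw [← smul_eq_mul]
  refine Finset.card_nsmul_le_sum _ _ _ fun A hA => ?_
  simp only [F, Finset.mem_filter, Finset.mem_univ, true_and] at hA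
  have hAD : #(A \ D) = l := by
    have h3 := Finset.card_sdiff_add_card_eq_card hA.1
    have h4 := card_eq_of_edgeLabels hk hA.2
    omega
  rw [← card_enumerations (A \ D) hAD]
  refine Finset.card_le_card fun x hx => ?_
  simp only [Finset.mem_filter, Finset.mem_univ, true_and] at hx ⊢
  have hx' : D ∪ univ.image x = A := by rw [hx, Finset.union_sdiff_of_subset hA.1]
  exact ⟨hx' ▸ hA.2, hx'⟩

/-- Completions inside `S` already give enough edges of the induced hypergraph. The slack in `m ≤ #S
+ t + 1` lets the binomial refer to the larger set `U_i ∪ T_j`, although `u_i` has been removed. -/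
theorem le_minDegree_induce {ν : W ↪ V} (hν : Set.range ν = H.vertexSet)
    (hk : H.IsUniform k) (hdl : d + l = k) {t m : ℕ} {θ : ℝ} (hθ : 0 ≤ θ) {S T A : Finset W}
    (hA : A = S ∪ T) (hR : Rich (EdgeLabels H ν) d l t θ T S) (hm : m ≤ #S + t + 1) (hd : d ≤ #S) :
    θ * (m.choose l : ℝ) ≤ ((H.induce (ν '' (A : Set W))).minDegree d : ℝ) := by
  subst hA
  set A := S ∪ T with hA
  have hAV : ν '' (A : Set W) ⊆ H.vertexSet := by
    rw [← hν]
    exact Set.image_subset_range _ _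
  -- The infimum is attained only if there is a set of `d` vertices at all; otherwise it would be
  -- the default `0`.
  have hne : {x | ∃ D : Set V, D ⊆ (H.induce (ν '' (A : Set W))).vertexSet ∧
      D.encard = d ∧ (H.induce (ν '' (A : Set W))).degree D = x}.Nonempty := by
    obtain ⟨D, hD, hDd⟩ := Finset.exists_subset_card_eq hd
    refine ⟨_, ν '' (D : Set W), Set.subset_inter ?_ ?_, ?_, rfl⟩
    · rw [← hν]
      exact Set.image_subset_range _ _
    · refine Set.image_mono ?_
      exact_mod_cast hD.trans Finset.subset_union_left
    · rw [ν.injective.encard_image, Set.encard_coe_eq_coe_finsetCard, hDd]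
  obtain ⟨D, hD, hDd, hdeg⟩ := Nat.sInf_mem hne
  obtain ⟨D', hD', rfl⟩ := exists_image_eq (hD.trans Set.inter_subset_right)
  rw [ν.injective.encard_image, Set.encard_coe_eq_coe_finsetCard] at hDd
  have hD'd : #D' = d := by exact_mod_cast hDd
  have h1 := hR D' hD' hD'd
  have h2 : θ * (m.choose l : ℝ) ≤ θ * ((#S + t + 1).choose l : ℝ) := by
    have : m.choose l ≤ (#S + t + 1).choose l := Nat.choose_le_choose l hm
    gcongr
  refine h2.trans (h1.trans ?_)
  have h3 : (H.induce (ν '' (A : Set W))).minDegree d =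
      (H.induce (ν '' (A : Set W))).degree (ν '' (D' : Set W)) := hdeg.symm
  rw [h3]
  have hfin : {e | e ∈ (H.induce (ν '' (A : Set W))).edgeSet ∧
      ν '' (D' : Set W) ⊆ e}.Finite := by
    refine (Set.toFinite (ν '' (A : Set W))).finite_subsets.subset ?_
    rintro e ⟨⟨-, he⟩, -⟩
    exact he
  have h4 : degIn (EdgeLabels H ν) l D' S ≤
      (H.induce (ν '' (A : Set W))).degree (ν '' (D' : Set W)) := by
    rw [degIn, ← Set.ncard_coe_finset]
    refine Set.ncard_le_ncard_of_injOn
      (fun X : Finset W => ν '' ((D' ∪ X : Finset W) : Set W)) ?_ ?_ hfin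
    · intro X hX
      simp only [Finset.coe_filter, Finset.mem_powersetCard, Set.mem_ofPred_eq] at hX
      refine ⟨⟨hX.2, Set.image_mono ?_⟩, Set.image_mono ?_⟩
      · exact_mod_cast Finset.union_subset hD' (hX.1.1.trans Finset.subset_union_left)
      · exact_mod_cast Finset.subset_union_left
    · intro X hX Y hY hXY
      simp only [Finset.coe_filter, Finset.mem_powersetCard, Set.mem_ofPred_eq] at hX hY
      -- As edges have `k = d + l` vertices, a completion is disjoint from `D'` and can be recovered
      -- from the edge, so distinct completions give distinct edges.
      have hdisj : ∀ Z : Finset W, #Z = l → EdgeLabels H ν (D' ∪ Z) →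
          (D' ∪ Z) \ D' = Z := by
        intro Z hZ hE
        have h5 := card_eq_of_edgeLabels hk hE
        have h6 := Finset.card_union_add_card_inter D' Z
        have h7 : D' ∩ Z = ∅ := Finset.card_eq_zero.1 (by omega)
        exact Finset.union_sdiff_cancel_left (Finset.disjoint_iff_inter_eq_empty.2 h7)
      have h8 : D' ∪ X = D' ∪ Y := Finset.coe_injective (ν.injective.image_injective hXY)
      rw [← hdisj X hX.1.2 hX.2, ← hdisj Y hY.1.2 hY.2, h8]
  exact_mod_cast h4

end

end SpreadPartition

open SpreadPartition in
theorem mainTheorem10 (k d t : ℕ) (hd : 1 ≤ d) (hdk : d < k) (ht : 1 ≤ t)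
    (α ε : ℝ) (hα : 0 < α) (hα1 : α ≤ 1) (hε : 0 < ε) (hε1 : ε ≤ 1) :
    ∃ C₀ : ℕ, ∀ C : ℕ, C₀ ≤ C →
    ∃ C'₀ : ℝ, ∀ C' : ℝ, C'₀ ≤ C' →
    ∃ n₀ : ℕ, ∀ n : ℕ, n₀ ≤ n →
    ∀ δ : ℝ, 0 ≤ δ → δ ≤ 1 →
    ∀ (V : Type*) (H : Hypergraph V), H.vertexSet.encard = n → H.IsUniform k →
      (δ + α) * ((n - d).choose (k - d) : ℝ) ≤ (H.minDegree d : ℝ) →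
      -- the random partition is the law `P` of an indexed family of `m` clusters;
      -- the exceptional cluster is the one of index `0`
      ∃ (m : ℕ) (hm : 0 < m) (P : PMF (Fin m → Set V)),
        (∀ U ∈ P.support,
          IsPartitionOf U H.vertexSet ∧
          -- sizes of the clusters
          (∀ i : Fin m, (i : ℕ) ≠ 0 → (U i).ncard = C) ∧
          (U ⟨0, hm⟩).ncard = (C - 1) * C + n % ((C - 1) * C) ∧
          -- minimum degree inside the clusters
          (∀ i : Fin m,
            (δ + α / 2) * ((U i).ncard.choose (k - d) : ℝ) ≤ ((H.induce (U i)).minDegree d : ℝ)) ∧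
          -- connecting minimum degree
          (∃ (u : Fin m → V) (T : Fin m → Set V) (N : Fin m → Finset (Fin m)),
            ∀ i : Fin m,
              u i ∈ U i ∧ T i ⊆ U i \ {u i} ∧ (T i).ncard = t ∧
              i ∉ N i ∧ (1 - ε) * (m : ℝ) ≤ ((N i).card : ℝ) ∧
              ∀ j ∈ N i,
                (δ + α / 2) * ((U i ∪ T j).ncard.choose (k - d) : ℝ) ≤
                  ((H.induce ((U i ∪ T j) \ {u i})).minDegree d : ℝ) ∧
                (δ + α / 2) * ((U j ∪ T i).ncard.choose (k - d) : ℝ) ≤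
                  ((H.induce ((U j ∪ T i) \ {u j})).minDegree d : ℝ))) ∧
        -- spreadness
        (∀ (s : ℕ) (y : Fin s → V), Function.Injective y → (∀ l, y l ∈ H.vertexSet) →
          ∀ f : Fin s → Fin m,
            P.toOuterMeasure {U | ∀ l, y l ∈ U (f l)} ≤ ENNReal.ofReal ((C' / (n : ℝ)) ^ s)) := by
  classical
  obtain ⟨l, hl⟩ : ∃ l, l = k - d := ⟨_, rfl⟩
  have hdl : d + l = k := by omega
  obtain ⟨c₀, hc₀1, hc₀⟩ := exists_spread_goodPartition d l t (by omega) α ε hα hα1 hε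
  refine ⟨c₀ + d + 1, fun C hC => ?_⟩
  obtain ⟨c, rfl⟩ : ∃ c, C = c + 1 := ⟨C - 1, by omega⟩
  obtain ⟨n₀, hn₀⟩ := hc₀ c (by omega)
  refine ⟨8 * (36 * (c * (c + 1)) + 120 * (c + 1)), fun C' hC' =>
    ⟨n₀ + d + l + ⌈8 * (l * (d + l)) / α⌉₊ + 1, fun n hn δ hδ hδ1 V H hV hk hdeg => ?_⟩⟩
  have hfin : H.vertexSet.Finite := Set.finite_of_encard_eq_coe hV
  -- The vertices are labelled by `Fin n`, since `V` may be infinite and lie in any universe.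
  obtain ⟨W, _, hWn, ν, hν⟩ : ∃ (W : Type) (_ : Fintype W), Fintype.card W = n ∧
      ∃ ν : W ↪ V, Set.range ν = H.vertexSet := by
    have : Finite H.vertexSet := hfin
    have hcard : Nat.card H.vertexSet = n := by
      rw [Nat.card_coe_set_eq, Set.ncard, hV, ENat.toNat_natCast]
    let e := (Finite.equivFinOfCardEq hcard).symm
    refine ⟨Fin n, inferInstance, Fintype.card_fin n, e.toEmbedding.trans (Function.Embedding.subtype _), ?_⟩
    ext v
    refine ⟨?_, fun hv => ⟨e.symm ⟨v, hv⟩, by simp⟩⟩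
    rintro ⟨i, rfl⟩
    exact (e i).2
  rw [← hl] at hdeg ⊢
  -- Passing from the binomial to `n^l` loses a factor `1 - α/8`, which costs at most `α/4` because
  -- `δ + α ≤ 2`.
  have hE : ∀ D : Finset W, D.card = d → (δ + 3 / 4 * α) * (n : ℝ) ^ l ≤
      (Finset.univ.filter fun x : Fin l → W =>
        EdgeLabels H ν (D ∪ Finset.univ.image x)).card := by
    intro D hD
    have h1 := le_card_completions hν hk hdl hD
    have h2 : ((H.minDegree d : ℝ) * (l.factorial : ℝ)) ≤
        (Finset.univ.filter fun x : Fin l → W =>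
          EdgeLabels H ν (D ∪ Finset.univ.image x)).card := by exact_mod_cast h1
    refine le_trans ?_ h2
    have h3 := le_choose_mul_factorial n d l 0 (α / 8) (by
      have h4 : (8 * (l * (d + l)) / α : ℝ) ≤ n :=
        (Nat.le_ceil _).trans (Nat.cast_le.2 (by omega))
      rw [div_le_iff₀ hα] at h4
      push_cast
      linarith) (by omega) (by omega)
    simp only [Nat.cast_zero, add_zero] at h3
    calc (δ + 3 / 4 * α) * (n : ℝ) ^ l ≤ ((δ + α) * (1 - α / 8)) * (n : ℝ) ^ l := by
          gcongr
          nlinarith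
      _ = (δ + α) * ((1 - α / 8) * (n : ℝ) ^ l) := by ring
      _ ≤ (δ + α) * ((n - d).choose l * (l.factorial : ℝ)) := by gcongr
      _ = ((δ + α) * (n - d).choose l) * (l.factorial : ℝ) := by ring
      _ ≤ _ := by gcongr
  obtain ⟨N, b, P, hb, hP, hP'⟩ := hn₀ n (by omega) δ hδ hδ1 W hWn (EdgeLabels H ν) hE
  have hinj := ν.injective
  refine ⟨N + 1, Nat.succ_pos _,
    P.map fun U i => ν '' (U i : Set W), fun U hU => ?_, fun s y hy hyV f => ?_⟩
  · obtain ⟨U, hUP, rfl⟩ := (PMF.mem_support_map_iff _ _ _).1 hU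
    obtain ⟨S, u, T, nb, hUS, hdisj, hcover, hS0, hSs, hmain⟩ := hP U hUP
    have hUcard : ∀ i, (ν '' (U i : Set W)).ncard = (S i).card + 1 := by
      intro i
      rw [Set.ncard_image_of_injective _ hinj, Set.ncard_coe_finset, (hUS i).1,
        Finset.card_insert_of_notMem (hUS i).2]
    have hSd : ∀ i, d ≤ (S i).card := by
      refine Fin.cases ?_ fun i => ?_
      · rw [hS0]
        have : c * 1 ≤ c * (c + 1) := Nat.mul_le_mul_left c (by omega)
        omega
      · rw [hSs i]
        omega
    have hθ : 0 ≤ δ + α / 2 := by positivity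
    have hconn : ∀ i j, i ≠ j →
        Rich (EdgeLabels H ν) d l t (δ + α / 2) (T j) (S i) → T j ⊆ S j → (T j).card = t →
        (δ + α / 2) *
          ((ν '' (U i : Set W) ∪ ν '' (T j : Set W)).ncard.choose l : ℝ) ≤
          ((H.induce ((ν '' (U i : Set W) ∪ ν '' (T j : Set W)) \
            {ν (u i)})).minDegree d : ℝ) := by
      intro i j hij hR hTj hTt
      have hui : u i ∉ T j := by
        intro h
        have h1 : u i ∈ U i := by rw [(hUS i).1]; exact Finset.mem_insert_self _ _
        have h2 : u i ∈ U j := by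
          rw [(hUS j).1]
          exact Finset.mem_insert_of_mem (hTj h)
        exact Finset.disjoint_left.1 (hdisj i j hij) h1 h2
      have hset : (ν '' (U i : Set W) ∪ ν '' (T j : Set W)) \ {ν (u i)} =
          ν '' ((S i ∪ T j : Finset W) : Set W) := by
        rw [← Set.image_union, ← Set.image_singleton, ← Set.image_sdiff hinj]
        congr 1
        ext v
        simp only [(hUS i).1, Finset.coe_insert, Finset.coe_union, Set.mem_sdiff, Set.mem_union,
          Set.mem_insert_iff, Finset.mem_coe, Set.mem_singleton_iff]
        constructor
        · rintro ⟨(h | h) | h, h'⟩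
          · exact absurd h h'
          · exact Or.inl h
          · exact Or.inr h
        · rintro (h | h)
          · refine ⟨Or.inl (Or.inr h), ?_⟩
            rintro rfl
            exact (hUS i).2 h
          · refine ⟨Or.inr h, ?_⟩
            rintro rfl
            exact hui h
      rw [hset]
      refine le_minDegree_induce hν hk hdl hθ rfl hR ?_ (hSd i)
      refine (Set.ncard_union_le _ _).trans ?_
      rw [hUcard, Set.ncard_image_of_injective _ hinj, Set.ncard_coe_finset, hTt]
      omega
    refine ⟨⟨fun i => ?_, fun i j hij => ?_, ?_⟩, ?_, ?_, ?_,
      fun i => ν (u i), fun i => ν '' (T i : Set W), nb, ?_⟩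
    · refine Set.Nonempty.image _ ⟨u i, ?_⟩
      rw [(hUS i).1]
      exact Finset.mem_insert_self _ _
    · rw [Set.disjoint_image_iff hinj]
      exact_mod_cast hdisj i j hij
    · rw [← Set.image_iUnion, ← hν, ← Set.image_univ]
      congr 1
      rw [Set.eq_univ_iff_forall]
      intro v
      obtain ⟨i, hi⟩ := hcover v
      exact Set.mem_iUnion.2 ⟨i, hi⟩
    · intro i hi
      obtain ⟨j, rfl⟩ := Fin.exists_succ_eq.2 (fun h : i = 0 => hi (by simp [h]))
      rw [hUcard, hSs j]
    · change (ν '' (U 0 : Set W)).ncard = _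
      rw [hUcard, hS0, hb, Nat.add_sub_cancel]
    · intro i
      refine le_minDegree_induce hν hk hdl hθ (S := S i) (T := {u i}) ?_ (hmain i).1 ?_ (hSd i)
      · rw [(hUS i).1, Finset.union_comm]
        ext v
        simp
      · rw [hUcard]
        omega
    · intro i
      obtain ⟨-, hTS, hTt, hnb, hcard, hR⟩ := hmain i
      refine ⟨?_, ?_, ?_, hnb, ?_, fun j hj => ?_⟩
      · refine Set.mem_image_of_mem _ ?_
        rw [(hUS i).1]
        exact Finset.mem_insert_self _ _
      · rintro _ ⟨v, hv, rfl⟩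
        refine ⟨Set.mem_image_of_mem _ ?_, ?_⟩
        · rw [(hUS i).1]
          exact Finset.mem_insert_of_mem (hTS hv)
        · intro h
          have h' : v = u i := hinj h
          exact (hUS i).2 (h' ▸ hTS hv)
      · rw [Set.ncard_image_of_injective _ hinj, Set.ncard_coe_finset, hTt]
      · push_cast
        exact hcard
      · have hij : i ≠ j := fun h => hnb (h ▸ hj)
        obtain ⟨-, hTSj, hTtj, -⟩ := hmain j
        exact ⟨hconn i j hij (hR j hj).1 hTSj hTtj, hconn j i hij.symm (hR j hj).2 hTS hTt⟩
  · have hy' : ∀ i, ∃ v, ν v = y i := fun i => by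
      have := hyV i
      rwa [← hν] at this
    choose w hw using hy'
    let y' : Fin s ↪ W := ⟨w, fun i j h => hy (by rw [← hw, ← hw, h])⟩
    have h1 := hP' s y' f
    rw [PMF.toOuterMeasure_map_apply]
    have hsub : (fun (U : Fin (N + 1) → Finset W) i => ν '' (U i : Set W)) ⁻¹'
        {U | ∀ i, y i ∈ U (f i)} ⊆ {U | ∀ i, y' i ∈ U (f i)} := by
      intro U hU i
      obtain ⟨v, hv, hv'⟩ := hU i
      have : v = w i := hinj (hv'.trans (hw i).symm)
      change w i ∈ U (f i)
      rw [← this]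
      exact hv
    refine (MeasureTheory.measure_mono hsub).trans (h1.trans (ENNReal.ofReal_le_ofReal ?_))
    gcongr
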